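/- In the Massively Parallel Computation (MPC) model, $\mathcal M$ machines with $S$ words of space each, a word having $O(\log n)$ bits, compute in synchronous rounds. In each round every machine performs an arbitrary (randomized) local computation on the content of its memory and sends messages to the machines (what it keeps is counted as a message to itself). The messages that a machine sends in a round, and those that it receives in a round, must have at most $S$ words in total. Initially each edge of the input graph is stored, as two words, on exactly one machine, in an arbitrary way such that no machine holds more than $S$ words. Local computation is unrestricted; $n$ and $m$ are known to the machines. **Theorem.** There are absolute constants $R$, $c$ and $K$ such that for every $\varepsilon>0$ and every $\kappa\in\mathbb N$ there are a constant $C=C(\varepsilon,\kappa)$ and a space bound $S=S(n)$ with $$n\le S(n)\le C\,n\log^{c}(n+2)\qquad\text{for all } n$$ (so $S=\widetilde\Theta(n)$) for which the following holds. For all $n$ and $m\le\binom n2$ there is a randomized MPC algorithm with $S$ words of at most $K\log(n+2)$ bits of space per machine and $R$ rounds whose machines can together hold any $m$ edges, whose total space satisfies $$\mathcal M\cdot S\le C\,\max\{n,m\}\,\log^{c}(n+2),$$ i.e. it is $\widetilde O(m)$ whenever $m\ge n$ (one machine alone already has space $\widetilde\Theta(n)$), and which has the following properties for every graph $G$ with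 $n$ vertices, $m$ edges and average degree $d_{avg}$, and every initial distribution of its edges. Let $T$ be the number of triangles of $G$. 1. The algorithm never violates the space limits, whatever its random choices are. 2. If $T\ge\sqrt{d_{avg}}$, then with probability at least $1-n^{-\kappa}$ the algorithm outputs a number $Y$ with $|Y-T|\le\varepsilon T$ (for $n=0$ read $d_{avg}=0$, and $n^{-\kappa}=0$ if $\kappa\ge1$). -/

import Mathlib

namespace MPC

/-- A machine word of `b` bits. -/
abbrev Word (b : ℕ) : Type := Fin (2 ^ b)

/-- The content of the local memory of one of `M` machines at the beginning of a round: the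
messages (lists of words) that it received in the previous round, indexed by their senders.
What a machine wants to keep, it sends to itself. -/
abbrev Memory (M b : ℕ) : Type := Fin M → List (Word b)

/-- The random choices of an execution with `R` rounds: in every round, every machine draws `S`
fresh uniformly random words, which only this machine sees. -/
abbrev Coins (M S b R : ℕ) : Type := Fin R → Fin M → Fin S → Word b

/-- A randomized MPC algorithm with `M` machines, `S` words of `b` bits of space per machine, and
`R` rounds. Local computation is unrestricted; the space limits are expressed
by `Algorithm.RespectsSpace`. -/
structure Algorithm (M S b R : ℕ) where
  /-- `step t j mem r i` is the message that machine `j` sends to machine `i` in round `t`, if `mem`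
  is its memory content and `r` are the random words that it draws. -/
  step : Fin R → Fin M → Memory M b → (Fin S → Word b) → Fin M → List (Word b)
  /-- The machine that announces the result after the last round. -/
  leader : Fin M
  /-- The result, computed from the final memory content of the leader. -/
  output : Memory M b → ℚ

namespace Algorithm

variable {M S b R : ℕ}

/-- `A.memory init ω t i` is the memory content of machine `i` after `t` rounds. -/
def memory (A : Algorithm M S b R) (init : Fin M → Memory M b) (ω : Coins M S b R) :
    Fin (R + 1) → Fin M → Memory M b :=
  Fin.induction (motive := fun _ => Fin M → Memory M b) init
    (fun t mem i j => A.step t j (mem j) (ω t j) i)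

/-- At all times the memory content of each machine (everything that it received, from itself or
from others) has at most `S` words, and in every round the messages sent by each machine
(to itself or to others) have at most `S` words in total. -/
def RespectsSpace (A : Algorithm M S b R) (init : Fin M → Memory M b) (ω : Coins M S b R) :
    Prop :=
  (∀ t i, ∑ j, (A.memory init ω t i j).length ≤ S) ∧
  (∀ (t : Fin R) (j : Fin M),
    ∑ i, (A.step t j (A.memory init ω t.castSucc j) (ω t j) i).length ≤ S)

/-- The number announced by the leader at the end of the execution. -/
def result (A : Algorithm M S b R) (init : Fin M → Memory M b) (ω : Coins M S b R) : ℚ :=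
  A.output (A.memory init ω (Fin.last R) A.leader)

end Algorithm

/-- `input` is a distribution of the edges of `G` among `M` machines of `S` words each: every edge
is stored exactly once, in one of its two orientations, and no machine holds more than
`S` words, where an edge takes two words. -/
def IsEdgeDistribution {n M : ℕ} (G : SimpleGraph (Fin n)) [DecidableRel G.Adj] (S : ℕ)
    (input : Fin M → List (Fin n × Fin n)) : Prop :=
  (∑ i, (input i : Multiset (Fin n × Fin n)).map (fun e => s(e.1, e.2))) = G.edgeFinset.val ∧
  ∀ i, 2 * (input i).length ≤ S

/-- The initial memory contents: each machine holds the endpoints of its edges, a word each. -/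
def initialMemory {n M b : ℕ} (hb : n ≤ 2 ^ b) (input : Fin M → List (Fin n × Fin n)) :
    Fin M → Memory M b :=
  fun i j =>
    if j = i then (input i).flatMap (fun e => [Fin.castLE hb e.1, Fin.castLE hb e.2]) else []

/-- The average degree of a graph on `n` vertices. -/
noncomputable def avgDegree {n : ℕ} (G : SimpleGraph (Fin n)) [DecidableRel G.Adj] : ℝ :=
  (∑ v, (G.degree v : ℝ)) / n

/-- The number of triangles of a graph. -/
def triangleCount {n : ℕ} (G : SimpleGraph (Fin n)) [DecidableRel G.Adj] : ℕ :=
  (G.cliqueFinset 3).card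

end MPC

/-! Each of `r` parallel repetitions, with `r` logarithmic in `n`, maps every vertex to a random
point of the affine plane over a field with `q` elements. A machine stands for a repetition and one
of the `q ^ 2` non-vertical lines, and it receives the edges whose endpoints lie on its line with
distinct first coordinates. Two such points determine the line, so an edge is sent at most once per
repetition, and a line expects about `m / q ^ 2` edges. A triangle is seen, by exactly one machine
of the repetition, if its three points are aligned; this has probability `alignProb`, about `1 / q`.

Aligned triangles are almost pairwise uncorrelated, even if they share an edge: the second triangle
has a vertex outside the first, and its point is independent of everything else
(`expect_aligned_mul_le`). Hence the number of triangles seen has mean `μ = alignProb * T` and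
variance at most `μ + μ ^ 2 / (q - 1)` (`expect_sq_le`). With `q ^ 2` of order `m / n`, an average
load is of order `n`, and `T ≥ √d_avg` makes `T / q`, hence `μ`, at least a large constant
(`le_alignProb_mul`).

Overloaded machines report `0` to respect the space limits. By Markov's inequality, applied to the
sum over lines of triangles times edges, few triangles are lost in this way (`expect_load_le`). So a
repetition fails with probability at most `1 / 16` (`card_bad_le`), a majority vote over the
repetitions lowers this to `2 ^ (-r) ≤ n ^ (-κ)` (`card_majority_bad`), and if `m` is at most a
constant times `n`, a single machine counts exactly. -/

namespace MPC

/-! ### Messages -/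

/-- A list of edges as a list of words. -/
def encode {n b : ℕ} (hb : n ≤ 2 ^ b) (l : List (Fin n × Fin n)) : List (Word b) :=
  l.flatMap (fun e => [Fin.castLE hb e.1, Fin.castLE hb e.2])

/-- The list of edges that a list of words stands for. -/
def decode (n : ℕ) {b : ℕ} : List (Word b) → List (Fin n × Fin n)
  | x :: y :: l => if h : x.1 < n ∧ y.1 < n then (⟨x, h.1⟩, ⟨y, h.2⟩) :: decode n l else decode n l
  | _ => []

theorem decode_encode {n b : ℕ} (hb : n ≤ 2 ^ b) (l : List (Fin n × Fin n)) :
    decode n (encode hb l) = l := by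
  induction l with
  | nil => rfl
  | cons e l ih =>
    obtain ⟨u, v⟩ := e
    change decode n (Fin.castLE hb u :: Fin.castLE hb v :: encode hb l) = _
    rw [decode, ih, dif_pos ⟨u.2, v.2⟩]
    rfl

@[simp] theorem length_encode {n b : ℕ} (hb : n ≤ 2 ^ b) (l : List (Fin n × Fin n)) :
    (encode hb l).length = 2 * l.length := by
  simp [encode, List.length_flatMap, mul_comm]

@[simp] theorem encode_nil {n b : ℕ} (hb : n ≤ 2 ^ b) : encode hb [] = [] := rfl

theorem encode_flatMap {ι : Type*} {n b : ℕ} (hb : n ≤ 2 ^ b) (l : List ι)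
    (f : ι → List (Fin n × Fin n)) :
    encode hb (l.flatMap f) = l.flatMap (fun i => encode hb (f i)) := by
  simp [encode, List.flatMap_assoc]

theorem initialMemory_eq {n M b : ℕ} (hb : n ≤ 2 ^ b) (input : Fin M → List (Fin n × Fin n))
    (i j : Fin M) : initialMemory hb input i j = if j = i then encode hb (input i) else [] := rfl

/-- The `i`-th of `M` consecutive blocks of almost equal length of a list. -/
def chunk {α : Type*} (M : ℕ) (l : List α) (i : ℕ) : List α :=
  (l.drop (i * (l.length / M + 1))).take (l.length / M + 1)

theorem length_chunk_le {α : Type*} (M : ℕ) (l : List α) (i : ℕ) :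
    (chunk M l i).length ≤ l.length / M + 1 := by
  simp [chunk]

theorem sum_chunk {α : Type*} {M : ℕ} (hM : 0 < M) (l : List α) :
    ∑ i : Fin M, (chunk M l i : Multiset α) = l := by
  have key : ∀ k : ℕ, ∑ i ∈ Finset.range k, (chunk M l i : Multiset α) =
      (l.take (k * (l.length / M + 1)) : Multiset α) := by
    intro k
    induction k with
    | zero => simp
    | succ k ih =>
      rw [Finset.sum_range_succ, ih, Nat.succ_mul, List.take_add, Multiset.coe_add, chunk]
  rw [Fin.sum_univ_eq_sum_range (fun i => (chunk M l i : Multiset α)) M, key, List.take_of_length_le]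
  have := Nat.lt_mul_div_succ l.length hM
  linarith

theorem coe_finRange_flatMap {α : Type*} {M : ℕ} (f : Fin M → List α) :
    ((List.finRange M).flatMap f : Multiset α) = ∑ i, (f i : Multiset α) := by
  rw [← Multiset.coe_bind, Multiset.bind, Multiset.join, Finset.sum, Fin.univ_val_map]
  simp [List.ofFn_eq_map, Multiset.map_coe]

theorem length_finRange_flatMap {α : Type*} {M : ℕ} (f : Fin M → List α) :
    ((List.finRange M).flatMap f).length = ∑ i, (f i).length := by
  rw [← Multiset.coe_card, coe_finRange_flatMap, Multiset.card_sum]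
  simp

/-- The edges of machine `i` after the input has been spread evenly. -/
def spread {α : Type*} {M : ℕ} (input : Fin M → List α) (i : Fin M) : List α :=
  (List.finRange M).flatMap fun j => chunk M (input j) i

theorem sum_spread {α : Type*} {M : ℕ} (hM : 0 < M) (input : Fin M → List α) :
    ∑ i, (spread input i : Multiset α) = ∑ i, (input i : Multiset α) := by
  simp only [spread, coe_finRange_flatMap]
  rw [Finset.sum_comm]
  exact Finset.sum_congr rfl fun j _ => sum_chunk hM (input j)

/-- Each sender cuts its list into blocks with a rounding error of at most one edge, which accounts
for the summand `M`. Spreading is needed because an edge is later sent up to `r` times, which a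
machine with a full initial memory could not do. -/
theorem length_spread_le {α : Type*} {M : ℕ} (input : Fin M → List α) (i : Fin M) :
    (spread input i).length ≤ (∑ j, (input j).length) / M + M := by
  rw [spread, length_finRange_flatMap]
  calc ∑ j, (chunk M (input j) i).length ≤ ∑ j, ((input j).length / M + 1) :=
        Finset.sum_le_sum fun j _ => length_chunk_le M _ _
    _ = ∑ j, (input j).length / M + M := by simp [Finset.sum_add_distrib]
    _ ≤ _ := by
        gcongr
        rw [Nat.le_div_iff_mul_le i.pos, Finset.sum_mul]
        exact Finset.sum_le_sum fun j _ => Nat.div_mul_le_self _ _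

/-! ### Graphs given by lists of edges -/

/-- The graph with the edges in a list. -/
def listGraph {n : ℕ} (l : List (Fin n × Fin n)) : SimpleGraph (Fin n) :=
  SimpleGraph.fromRel fun u v => (u, v) ∈ l

open Classical in
/-- The number of triangles of the graph with the edges in a list. -/
noncomputable def listTriangles {n : ℕ} (l : List (Fin n × Fin n)) : ℕ :=
  triangleCount (listGraph l)

theorem triangleCount_le {n : ℕ} (G : SimpleGraph (Fin n)) [DecidableRel G.Adj] :
    triangleCount G ≤ n ^ 3 := by
  calc triangleCount G ≤ (Finset.powersetCard 3 (Finset.univ : Finset (Fin n))).card := by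
        refine Finset.card_le_card fun s hs => ?_
        rw [SimpleGraph.mem_cliqueFinset_iff] at hs
        simp [Finset.mem_powersetCard, hs.card_eq]
    _ ≤ n ^ 3 := by
        rw [Finset.card_powersetCard, Finset.card_univ, Fintype.card_fin]
        exact Nat.choose_le_pow n 3

/-- The two decidability instances are unrelated, so an equality of graphs alone does not rewrite
`triangleCount`. -/
theorem triangleCount_congr {n : ℕ} {G H : SimpleGraph (Fin n)} [DecidableRel G.Adj]
    [DecidableRel H.Adj] (h : G = H) : triangleCount G = triangleCount H := by
  subst h
  unfold triangleCount
  congr!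

/-- The subgraph of the edges on which a symmetric relation holds. -/
def selGraph {n : ℕ} (G : SimpleGraph (Fin n)) (sel : Fin n → Fin n → Prop) :
    SimpleGraph (Fin n) where
  Adj u v := G.Adj u v ∧ sel u v ∧ sel v u
  symm := ⟨fun _ _ h => ⟨h.1.symm, h.2.2, h.2.1⟩⟩
  loopless := ⟨fun _ h => G.loopless.irrefl _ h.1⟩

theorem IsEdgeDistribution.adj_iff {n M S : ℕ} {G : SimpleGraph (Fin n)} [DecidableRel G.Adj]
    {input : Fin M → List (Fin n × Fin n)} (h : IsEdgeDistribution G S input) (u v : Fin n) :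
    G.Adj u v ↔ (u, v) ∈ ∑ i, (input i : Multiset (Fin n × Fin n)) ∨
      (v, u) ∈ ∑ i, (input i : Multiset (Fin n × Fin n)) := by
  have h1 : (∑ i, (input i : Multiset (Fin n × Fin n))).map (fun e => s(e.1, e.2)) =
      G.edgeFinset.val := by
    rw [← h.1]
    exact map_sum (Multiset.mapAddMonoidHom (fun e : Fin n × Fin n => s(e.1, e.2))) _ _
  rw [← SimpleGraph.mem_edgeSet, ← SimpleGraph.mem_edgeFinset, ← Finset.mem_val, ← h1,
    Multiset.mem_map]
  constructor
  · rintro ⟨⟨a, c⟩, ha, he⟩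
    rcases Sym2.eq_iff.1 he with ⟨rfl, rfl⟩ | ⟨rfl, rfl⟩
    · exact Or.inl ha
    · exact Or.inr ha
  · rintro (h | h)
    · exact ⟨_, h, rfl⟩
    · exact ⟨_, h, Sym2.eq_swap⟩

theorem IsEdgeDistribution.sum_length {n M S : ℕ} {G : SimpleGraph (Fin n)} [DecidableRel G.Adj]
    {input : Fin M → List (Fin n × Fin n)} (h : IsEdgeDistribution G S input) :
    ∑ i, (input i).length = G.edgeFinset.card := by
  rw [Finset.card_def, ← h.1, Multiset.card_sum]
  simp

open Classical in
-- The lists contain each edge exactly once, in one orientation, and the symmetry of `sel` makes the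
-- orientation irrelevant.
theorem IsEdgeDistribution.card_filter {n M S : ℕ} {G : SimpleGraph (Fin n)} [DecidableRel G.Adj]
    {input : Fin M → List (Fin n × Fin n)} (h : IsEdgeDistribution G S input)
    (sel : Fin n → Fin n → Prop) (hsel : ∀ u v, sel u v → sel v u) :
    ((∑ i, (input i : Multiset (Fin n × Fin n))).filter (fun e => sel e.1 e.2)).card =
      (selGraph G sel).edgeFinset.card := by
  have h1 : (∑ i, (input i : Multiset (Fin n × Fin n))).map (fun e => s(e.1, e.2)) =
      G.edgeFinset.val := by
    rw [← h.1]
    exact map_sum (Multiset.mapAddMonoidHom (fun e : Fin n × Fin n => s(e.1, e.2))) _ _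
  have h2 : (selGraph G sel).edgeFinset =
      G.edgeFinset.filter (fun e => e ∈ Sym2.fromRel (r := fun u v => sel u v ∧ sel v u)
        ⟨fun _ _ h => h.symm⟩) := by
    ext e
    induction e with
    | _ u v => rw [SimpleGraph.mem_edgeFinset]; simp [selGraph]
  rw [h2, Finset.card_def, Finset.filter_val, ← h1, Multiset.filter_map, Multiset.card_map]
  congr 1
  refine Multiset.filter_congr fun e _ => ?_
  simp only [Function.comp_apply, Sym2.fromRel_prop]
  exact ⟨fun h => ⟨h, hsel _ _ h⟩, fun h => h.1⟩

/-! ### The algorithm -/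

/-- A number as a word. -/
def toWord (b x : ℕ) : Word b := ⟨x % 2 ^ b, Nat.mod_lt _ (by positivity)⟩

open Classical in
/-- The edges in a list on which a relation holds. -/
noncomputable def select {n : ℕ} (sel : Fin n → Fin n → Prop) (l : List (Fin n × Fin n)) :
    List (Fin n × Fin n) :=
  l.filter fun e => sel e.1 e.2

/-- A message that consists of colours, a number, and edges. -/
def packet {b : ℕ} (a : List (Word b)) (x : ℕ) (l : List (Word b)) : List (Word b) :=
  a ++ toWord b x :: l

/-- The number in a packet with `w` colours. -/
def packetValue {b : ℕ} (w : ℕ) (l : List (Word b)) : ℕ := (l.getD w (toWord b 0)).val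

section Packet

variable {b w : ℕ} {a : List (Word b)}

theorem take_packet (ha : a.length = w) (x : ℕ) (l : List (Word b)) :
    (packet a x l).take w = a := by
  simp [packet, ← ha]

theorem drop_packet (ha : a.length = w) (x : ℕ) (l : List (Word b)) :
    (packet a x l).drop (w + 1) = l := by
  simp [packet, ← ha]

theorem packetValue_packet (ha : a.length = w) {x : ℕ} (l : List (Word b)) (hx : x < 2 ^ b) :
    packetValue w (packet a x l) = x := by
  simp [packetValue, packet, ← ha, toWord, Nat.mod_eq_of_lt hx]

theorem length_packet (ha : a.length = w) (x : ℕ) (l : List (Word b)) :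
    (packet a x l).length = w + 1 + l.length := by
  simp [packet, ha]; omega

theorem getD_packet (ha : a.length = w) (x : ℕ) (l : List (Word b)) {s : ℕ} (hs : s < w)
    (d : Word b) : (packet a x l).getD s d = a.getD s d := by
  subst ha
  rw [packet, List.getD_append _ _ _ _ hs]

end Packet

/-- The colours announced in packets: the `ρ`-th colour of `v` is in position `slot ρ v` of the
packet of machine `own v`. -/
def colours {n M b r : ℕ} (own : Fin n → Fin M) (slot : Fin r → Fin n → ℕ) (mem : Memory M b) :
    Fin r → Fin n → Word b :=
  fun ρ v => (mem (own v)).getD (slot ρ v) (toWord b 0)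

/-- The machines spread the edges evenly, announce random colours of the vertices (each machine
announces `w` of them), and send edge `uv` to machine `i` if the colours satisfy `sel _ i u v`,
unless more than `S / 2` edges would go to machine `i`. Then machine `i` counts the triangles in
the graph that it received; the output is a function of these numbers. -/
noncomputable def sampler {n M b r : ℕ} (S : ℕ) (hb : n ≤ 2 ^ b) (w : ℕ) (own : Fin n → Fin M)
    (slot : Fin r → Fin n → ℕ)
    (sel : (Fin r → Fin n → Word b) → Fin M → Fin n → Fin n → Prop) (leader : Fin M)
    (out : (Fin M → ℕ) → ℚ) : Algorithm M S b 6 where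
  step t j mem coin i := match t with
    | 0 => encode hb (chunk M (decode n (mem j)) i)
    -- A memory holds only the messages of the preceding round. So the colours are sent to all
    -- machines in this and the next two rounds, and each machine sends its edges to itself.
    | 1 => packet ((List.ofFn coin).take w) 0
        (if i = j then (List.finRange M).flatMap mem else [])
    -- The number is the count of edges that `j` would send to `i`.
    | 2 => packet ((mem j).take w)
        (select (sel (colours own slot mem) i) (decode n ((mem j).drop (w + 1)))).length
        (if i = j then (mem j).drop (w + 1) else [])
    -- The number is now a single bit: whether `j` accepts the edges destined for it.
    | 3 => packet ((mem j).take w) (if ∑ k, packetValue w (mem k) ≤ S / 2 then 1 else 0)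
        (if i = j then (mem j).drop (w + 1) else [])
    | 4 => if packetValue w (mem i) = 1 then
          encode hb (select (sel (colours own slot mem) i) (decode n ((mem j).drop (w + 1))))
        else []
    | 5 => if i = leader then
          [toWord b (listTriangles ((List.finRange M).flatMap fun k => decode n (mem k)))]
        else []
  leader := leader
  output mem := out fun j => packetValue 0 (mem j)

/-- The block of `w` words drawn by machine `j` in the second round. -/
def drawnBlock {M S b : ℕ} (w : ℕ) (ω : Coins M S b 6) (j : Fin M) : List (Word b) :=
  (List.ofFn (ω 1 j)).take w

/-- The colours that are drawn in the second round. -/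
def drawnColours {n M S b r w : ℕ} (own : Fin n → Fin M) (slot : Fin r → Fin n → ℕ)
    (hslot : ∀ ρ v, slot ρ v < w) (hw : w ≤ S) (ω : Coins M S b 6) : Fin r → Fin n → Word b :=
  fun ρ v => ω 1 (own v) ⟨slot ρ v, (hslot ρ v).trans_le hw⟩

theorem length_drawnBlock {M S b w : ℕ} (hw : w ≤ S) (ω : Coins M S b 6) (j : Fin M) :
    (drawnBlock w ω j).length = w := by simpa [drawnBlock] using hw

theorem getD_drawnBlock {n M S b r w : ℕ} {own : Fin n → Fin M} {slot : Fin r → Fin n → ℕ}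
    (hslot : ∀ ρ v, slot ρ v < w) (hw : w ≤ S) (ω : Coins M S b 6) (ρ : Fin r) (v : Fin n) :
    (drawnBlock w ω (own v)).getD (slot ρ v) (toWord b 0) =
      drawnColours own slot hslot hw ω ρ v := by
  have h1 := hslot ρ v
  have h2 : slot ρ v < S := h1.trans_le hw
  simp [drawnBlock, List.getD, h1, h2, drawnColours]

open Classical in
theorem coe_flatMap_select {n M : ℕ} (s : Fin n → Fin n → Prop)
    (f : Fin M → List (Fin n × Fin n)) :
    ((List.finRange M).flatMap fun j => select s (f j) : Multiset (Fin n × Fin n)) =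
      (∑ i, (f i : Multiset (Fin n × Fin n))).filter fun e => s e.1 e.2 := by
  rw [← coe_finRange_flatMap, Multiset.filter_coe, List.filter_flatMap]
  rfl

open Classical in
theorem sum_select {n M S : ℕ} (hM : 0 < M) {G : SimpleGraph (Fin n)} [DecidableRel G.Adj]
    {input : Fin M → List (Fin n × Fin n)} (hinput : IsEdgeDistribution G S input)
    (s : Fin n → Fin n → Prop) (hs : ∀ u v, s u v → s v u) :
    ∑ j, (select s (spread input j)).length = (selGraph G s).edgeFinset.card := by
  rw [← hinput.card_filter s hs, ← sum_spread hM, ← coe_flatMap_select, Multiset.coe_card,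
    length_finRange_flatMap]

theorem listGraph_select {n M S : ℕ} (hM : 0 < M) {G : SimpleGraph (Fin n)} [DecidableRel G.Adj]
    {input : Fin M → List (Fin n × Fin n)} (hinput : IsEdgeDistribution G S input)
    (s : Fin n → Fin n → Prop) (hs : ∀ u v, s u v → s v u) :
    listGraph ((List.finRange M).flatMap fun j => select s (spread input j)) = selGraph G s := by
  classical
  ext u v
  have h : ∀ a c, (a, c) ∈ ((List.finRange M).flatMap fun j => select s (spread input j)) ↔
      (a, c) ∈ ∑ i, (input i : Multiset (Fin n × Fin n)) ∧ s a c := fun a c => by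
    rw [← Multiset.mem_coe, coe_flatMap_select, sum_spread hM, Multiset.mem_filter]
  rw [listGraph, SimpleGraph.fromRel_adj, h, h]
  change _ ↔ G.Adj u v ∧ s u v ∧ s v u
  constructor
  · rintro ⟨-, h | h⟩
    · exact ⟨(hinput.adj_iff _ _).2 (Or.inl h.1), h.2, hs _ _ h.2⟩
    · exact ⟨(hinput.adj_iff _ _).2 (Or.inr h.1), hs _ _ h.2, h.2⟩
  · rintro ⟨h1, h2, h3⟩
    refine ⟨h1.ne, ?_⟩
    rcases (hinput.adj_iff _ _).1 h1 with h | h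
    · exact Or.inl ⟨h, h2⟩
    · exact Or.inr ⟨h, h3⟩

theorem listGraph_flatMap {n M S : ℕ} {G : SimpleGraph (Fin n)} [DecidableRel G.Adj]
    {input : Fin M → List (Fin n × Fin n)} (hinput : IsEdgeDistribution G S input) :
    listGraph ((List.finRange M).flatMap input) = G := by
  ext u v
  rw [listGraph, SimpleGraph.fromRel_adj, ← Multiset.mem_coe, ← Multiset.mem_coe,
    coe_finRange_flatMap, ← hinput.adj_iff]
  exact ⟨fun h => h.2, fun h => ⟨h.ne, h⟩⟩

theorem selGraph_le {n : ℕ} (G : SimpleGraph (Fin n)) (s : Fin n → Fin n → Prop) :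
    selGraph G s ≤ G := fun _ _ h => h.1

/-! ### Execution of the sampler: memory contents, result, and space -/

section Sampler

variable {n M S b r w : ℕ} {hb : n ≤ 2 ^ b} {own : Fin n → Fin M}
  {slot : Fin r → Fin n → ℕ}
  {sel : (Fin r → Fin n → Word b) → Fin M → Fin n → Fin n → Prop} {leader : Fin M}
  {out : (Fin M → ℕ) → ℚ} {G : SimpleGraph (Fin n)} [DecidableRel G.Adj]
  {input : Fin M → List (Fin n × Fin n)} (ω : Coins M S b 6)

local notation "mm" => Algorithm.memory (sampler S hb w own slot sel leader out)
  (initialMemory hb input) ω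

theorem memory_one (i j : Fin M) : mm 1 i j = encode hb (chunk M (input j) i) := by
  change encode hb (chunk M (decode n (initialMemory hb input j j)) i) = _
  rw [initialMemory_eq, if_pos rfl, decode_encode]

theorem memory_two (i j : Fin M) :
    mm 2 i j = packet (drawnBlock w ω j) 0 (if i = j then encode hb (spread input j) else []) := by
  change packet (drawnBlock w ω j) 0
    (if i = j then (List.finRange M).flatMap (mm 1 j) else []) = _
  rw [spread, encode_flatMap]
  congr! 3
  exact funext fun k => memory_one ω j k

/-- All machines read the same colours from the packets, so they agree on the destinations of the
edges without further communication. -/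
theorem memory_three (hslot : ∀ ρ v, slot ρ v < w) (hw : w ≤ S) (i j : Fin M) :
    mm 3 i j = packet (drawnBlock w ω j)
      (select (sel (drawnColours own slot hslot hw ω) i) (spread input j)).length
      (if i = j then encode hb (spread input j) else []) := by
  change packet ((mm 2 j j).take w)
        (select (sel (colours own slot (mm 2 j)) i) (decode n ((mm 2 j j).drop (w + 1)))).length
        (if i = j then (mm 2 j j).drop (w + 1) else []) = _
  have hχ : colours own slot (mm 2 j) = drawnColours own slot hslot hw ω := by
    funext ρ v
    rw [colours, memory_two, getD_packet (length_drawnBlock hw ω _) _ _ (hslot ρ v),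
      getD_drawnBlock]
  rw [hχ, memory_two, take_packet (length_drawnBlock hw ω _),
    drop_packet (length_drawnBlock hw ω _), if_pos rfl, decode_encode]

open Classical in
theorem sum_packetValue_memory_three (hslot : ∀ ρ v, slot ρ v < w) (hw : w ≤ S)
    (hinput : IsEdgeDistribution G S input) (hsel : ∀ χ i u v, sel χ i u v → sel χ i v u)
    (hcard : G.edgeFinset.card < 2 ^ b) (i : Fin M) :
    ∑ k, packetValue w (mm 3 i k) =
      (selGraph G (sel (drawnColours own slot hslot hw ω) i)).edgeFinset.card := by
  rw [← sum_select i.pos hinput _ (hsel _ i)]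
  refine Finset.sum_congr rfl fun k _ => ?_
  rw [memory_three ω hslot hw, packetValue_packet (length_drawnBlock hw ω _)]
  refine lt_of_le_of_lt ?_ hcard
  calc _ ≤ ∑ j, (select (sel (drawnColours own slot hslot hw ω) i) (spread input j)).length :=
        Finset.single_le_sum (f := fun k => (select _ (spread input k)).length)
          (fun _ _ => Nat.zero_le _) (Finset.mem_univ k)
    _ = _ := sum_select i.pos hinput _ (hsel _ i)
    _ ≤ _ := Finset.card_le_card (SimpleGraph.edgeFinset_mono (selGraph_le G _))

open Classical in
theorem memory_four (hslot : ∀ ρ v, slot ρ v < w) (hw : w ≤ S)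
    (hinput : IsEdgeDistribution G S input) (hsel : ∀ χ i u v, sel χ i u v → sel χ i v u)
    (hcard : G.edgeFinset.card < 2 ^ b) (i j : Fin M) :
    mm 4 i j = packet (drawnBlock w ω j)
      (if (selGraph G (sel (drawnColours own slot hslot hw ω) j)).edgeFinset.card ≤ S / 2
        then 1 else 0)
      (if i = j then encode hb (spread input j) else []) := by
  change packet ((mm 3 j j).take w) (if ∑ k, packetValue w (mm 3 j k) ≤ S / 2 then 1 else 0)
        (if i = j then (mm 3 j j).drop (w + 1) else []) = _
  rw [sum_packetValue_memory_three ω hslot hw hinput hsel hcard, memory_three ω hslot hw,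
    take_packet (length_drawnBlock hw ω _), drop_packet (length_drawnBlock hw ω _), if_pos rfl]

open Classical in
theorem memory_five (hslot : ∀ ρ v, slot ρ v < w) (hw : w ≤ S)
    (hinput : IsEdgeDistribution G S input) (hsel : ∀ χ i u v, sel χ i u v → sel χ i v u)
    (hcard : G.edgeFinset.card < 2 ^ b) (hb0 : b ≠ 0) (i j : Fin M) :
    mm 5 i j =
      if (selGraph G (sel (drawnColours own slot hslot hw ω) i)).edgeFinset.card ≤ S / 2 then
        encode hb (select (sel (drawnColours own slot hslot hw ω) i) (spread input j)) else [] := by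
  change (if packetValue w (mm 4 j i) = 1 then
          encode hb (select (sel (colours own slot (mm 4 j)) i)
            (decode n ((mm 4 j j).drop (w + 1)))) else []) = _
  have hχ : colours own slot (mm 4 j) = drawnColours own slot hslot hw ω := by
    funext ρ v
    rw [colours, memory_four ω hslot hw hinput hsel hcard,
      getD_packet (length_drawnBlock hw ω _) _ _ (hslot ρ v), getD_drawnBlock]
  -- Words of `0` bits could not carry the acceptance bit.
  have hone : 1 < 2 ^ b := Nat.one_lt_two_pow hb0
  rw [hχ, memory_four ω hslot hw hinput hsel hcard, memory_four ω hslot hw hinput hsel hcard,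
    drop_packet (length_drawnBlock hw ω _), if_pos rfl, decode_encode,
    packetValue_packet (length_drawnBlock hw ω _)]
  · split_ifs <;> simp_all
  · split_ifs <;> omega

open Classical in
/-- The number of triangles on which a relation holds, or `0` if it holds on more than `τ`
edges. -/
noncomputable def cappedTriangles {n : ℕ} (G : SimpleGraph (Fin n)) (τ : ℕ)
    (s : Fin n → Fin n → Prop) : ℕ :=
  if (selGraph G s).edgeFinset.card ≤ τ then triangleCount (selGraph G s) else 0

theorem memory_six (hslot : ∀ ρ v, slot ρ v < w) (hw : w ≤ S)
    (hinput : IsEdgeDistribution G S input) (hsel : ∀ χ i u v, sel χ i u v → sel χ i v u)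
    (hcard : G.edgeFinset.card < 2 ^ b) (hb0 : b ≠ 0) (i j : Fin M) :
    mm 6 i j = if i = leader then
      [toWord b (cappedTriangles G (S / 2) (sel (drawnColours own slot hslot hw ω) j))] else [] := by
  classical
  change (if i = leader then [toWord b (listTriangles
    ((List.finRange M).flatMap fun k => decode n (mm 5 j k)))] else []) = _
  congr! 3
  simp only [memory_five ω hslot hw hinput hsel hcard hb0]
  rw [cappedTriangles]
  split_ifs
  · simp only [decode_encode]
    exact triangleCount_congr (listGraph_select j.pos hinput _ (hsel _ j))
  · have h0 : listGraph ([] : List (Fin n × Fin n)) = ⊥ := by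
      ext u v
      simp [listGraph]
    have : (List.finRange M).flatMap (fun _ => decode n ([] : List (Word b))) = [] := by
      simp [decode]
    rw [this, listTriangles, triangleCount_congr h0]
    simp [triangleCount, SimpleGraph.cliqueFree_bot]

theorem sampler_result (hslot : ∀ ρ v, slot ρ v < w) (hw : w ≤ S)
    (hinput : IsEdgeDistribution G S input) (hsel : ∀ χ i u v, sel χ i u v → sel χ i v u)
    (hcard : G.edgeFinset.card < 2 ^ b) (hb0 : b ≠ 0) (hcube : n ^ 3 < 2 ^ b) :
    (sampler S hb w own slot sel leader out).result (initialMemory hb input) ω =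
      out fun j => cappedTriangles G (S / 2) (sel (drawnColours own slot hslot hw ω) j) := by
  classical
  change out (fun j => packetValue 0 (mm 6 leader j)) = _
  congr 1
  funext j
  rw [memory_six ω hslot hw hinput hsel hcard hb0, if_pos rfl]
  have : cappedTriangles G (S / 2) (sel (drawnColours own slot hslot hw ω) j) < 2 ^ b := by
    refine lt_of_le_of_lt ?_ hcube
    rw [cappedTriangles]
    split_ifs
    · exact triangleCount_le _
    · exact Nat.zero_le _
  simp [packetValue, toWord, Nat.mod_eq_of_lt this]

/-- Three kinds of rounds matter: packets go to everyone but edges only to oneself (`hS`); when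
edges are delivered, a sender copies each edge to at most `r` machines (`hr`, `hS'`), while a
receiver is protected by the cap `S / 2` on edges of two words each. The remaining messages are the
initial spreading and single words to the leader. -/
theorem sampler_respectsSpace (hslot : ∀ ρ v, slot ρ v < w) (hw : w ≤ S)
    (hinput : IsEdgeDistribution G S input) (hsel : ∀ χ i u v, sel χ i u v → sel χ i v u)
    (hcard : G.edgeFinset.card < 2 ^ b) (hb0 : b ≠ 0)
    (hS : M * (w + 1) + 2 * (G.edgeFinset.card / M + M) ≤ S)
    (hr : ∀ χ u v, {i | sel χ i u v}.ncard ≤ r)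
    (hS' : 2 * (r * (G.edgeFinset.card / M + M)) ≤ S) :
    (sampler S hb w own slot sel leader out).RespectsSpace (initialMemory hb input) ω := by
  classical
  have hspread : ∀ i, (spread input i).length ≤ G.edgeFinset.card / M + M := fun i => by
    rw [← hinput.sum_length]
    exact length_spread_le input i
  have hM : M ≤ S :=
    (Nat.le_mul_of_pos_right M w.succ_pos).trans ((Nat.le_add_right _ _).trans hS)
  have hpack : ∀ (f : Fin M → Memory M b) (x : Fin M → Fin M → ℕ),
      (∀ i j, f i j = packet (drawnBlock w ω j) (x i j)
        (if i = j then encode hb (spread input j) else [])) →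
      (∀ j, ∑ i, (f i j).length ≤ S) ∧ ∀ i, ∑ j, (f i j).length ≤ S := by
    intro f x hf
    simp only [hf]
    rw [← forall_and]
    intro j
    have h1 := hspread j
    constructor <;>
    · simp only [length_packet (length_drawnBlock hw ω _), apply_ite List.length, length_encode,
        List.length_nil, Finset.sum_add_distrib, Finset.sum_ite_eq, Finset.sum_ite_eq',
        Finset.mem_univ, if_true]
      simp only [Finset.sum_const, Finset.card_univ, Fintype.card_fin, smul_eq_mul]
      rw [mul_add] at hS
      omega
  have h0 : ∀ i, ∑ j, (mm 0 i j).length ≤ S := fun i => by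
    change ∑ j, (initialMemory hb input i j).length ≤ S
    simp only [initialMemory_eq, apply_ite List.length, length_encode, List.length_nil,
      Finset.sum_ite_eq', Finset.mem_univ, if_true]
    exact hinput.2 i
  have h1 : ∀ i, ∑ j, (mm 1 i j).length ≤ S := fun i => by
    simp only [memory_one, length_encode, ← Finset.mul_sum]
    rw [← length_finRange_flatMap]
    have := hspread i
    rw [spread] at this
    omega
  have h1' : ∀ j, ∑ i, (mm 1 i j).length ≤ S := fun j => by
    simp only [memory_one, length_encode, ← Finset.mul_sum]
    have := congrArg Multiset.card (sum_chunk j.pos (input j))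
    simp only [Multiset.card_sum, Multiset.coe_card] at this
    rw [this]
    exact hinput.2 j
  have h5 : ∀ i, ∑ j, (mm 5 i j).length ≤ S := fun i => by
    simp only [memory_five ω hslot hw hinput hsel hcard hb0]
    split_ifs with h
    · simp only [length_encode, ← Finset.mul_sum]
      rw [sum_select i.pos hinput _ (hsel _ i)]
      omega
    · simp
  have h5' : ∀ j, ∑ i, (mm 5 i j).length ≤ S := fun j => by
    refine le_trans ?_ hS'
    calc ∑ i, (mm 5 i j).length ≤ ∑ i, 2 * (select (sel (drawnColours own slot hslot hw ω) i)
          (spread input j)).length := by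
          refine Finset.sum_le_sum fun i _ => ?_
          rw [memory_five ω hslot hw hinput hsel hcard hb0]
          split_ifs <;> simp
      _ ≤ 2 * (r * (spread input j).length) := by
          rw [← Finset.mul_sum]
          gcongr
          generalize spread input j = l
          induction l with
          | nil => simp [select]
          | cons e l ih =>
            have h2 := hr (drawnColours own slot hslot hw ω) e.1 e.2
            rw [Set.ncard_eq_toFinset_card', Set.toFinset_ofPred, Finset.card_filter] at h2
            have h3 : ∀ i, (select (sel (drawnColours own slot hslot hw ω) i) (e :: l)).length =
                (if sel (drawnColours own slot hslot hw ω) i e.1 e.2 then 1 else 0) +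
                (select (sel (drawnColours own slot hslot hw ω) i) l).length := fun i => by
              simp only [select, List.filter_cons, decide_eq_true_eq]
              split_ifs <;> simp [add_comm]
            simp only [h3, Finset.sum_add_distrib, List.length_cons]
            linarith
      _ ≤ _ := by gcongr; exact hspread j
  have h6 : ∀ i, ∑ j, (mm 6 i j).length ≤ S := fun i => by
    simp only [memory_six ω hslot hw hinput hsel hcard hb0]
    split_ifs <;> simp [hM]
  have h6' : ∀ j, ∑ i, (mm 6 i j).length ≤ S := fun j => by
    simp only [memory_six ω hslot hw hinput hsel hcard hb0, apply_ite List.length,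
      List.length_nil, Finset.sum_ite_eq', Finset.mem_univ, if_true]
    simp only [List.length_cons, List.length_nil]
    have := j.pos
    omega
  have h2 := hpack (fun i j => mm 2 i j) _ (memory_two ω)
  have h3 := hpack (fun i j => mm 3 i j) _ (memory_three ω hslot hw)
  have h4 := hpack (fun i j => mm 4 i j) _ (memory_four ω hslot hw hinput hsel hcard)
  constructor
  · intro t i
    fin_cases t
    · exact h0 i
    · exact h1 i
    · exact h2.2 i
    · exact h3.2 i
    · exact h4.2 i
    · exact h5 i
    · exact h6 i
  · intro t j
    change ∑ i, (mm t.succ i j).length ≤ S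
    fin_cases t
    · exact h1' j
    · exact h2.1 j
    · exact h3.1 j
    · exact h4.1 j
    · exact h5' j
    · exact h6' j

end Sampler

/-! ### Exact counting on one machine -/

/-- A single machine that holds all the edges and counts the triangles. -/
noncomputable def exactCounter (n S b R : ℕ) : Algorithm 1 S b R where
  step _ _ mem _ _ := mem 0
  leader := 0
  output mem := listTriangles (decode n (mem 0))

section ExactCounter

variable {n S b R : ℕ} (hb : n ≤ 2 ^ b) (input : Fin 1 → List (Fin n × Fin n))
  (ω : Coins 1 S b R)

theorem exactCounter_memory (t : Fin (R + 1)) (i j : Fin 1) :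
    (exactCounter n S b R).memory (initialMemory hb input) ω t i j = encode hb (input 0) := by
  obtain rfl := Subsingleton.elim i 0
  obtain rfl := Subsingleton.elim j 0
  induction t using Fin.induction with
  | zero =>
    change initialMemory hb input 0 0 = _
    rw [initialMemory_eq, if_pos rfl]
  | succ t ih => exact ih

variable {input} {G : SimpleGraph (Fin n)} [DecidableRel G.Adj]

theorem exactCounter_respectsSpace (hinput : IsEdgeDistribution G S input) :
    (exactCounter n S b R).RespectsSpace (initialMemory hb input) ω := by
  constructor
  · intro t i
    simp only [exactCounter_memory]
    simpa using hinput.2 0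
  · intro t j
    change ∑ i, ((exactCounter n S b R).memory (initialMemory hb input) ω t.succ i j).length ≤ S
    simp only [exactCounter_memory]
    simpa using hinput.2 0

theorem exactCounter_result (hinput : IsEdgeDistribution G S input) :
    (exactCounter n S b R).result (initialMemory hb input) ω = triangleCount G := by
  change ((listTriangles (decode n ((exactCounter n S b R).memory (initialMemory hb input) ω
    (Fin.last R) 0 0)) : ℕ) : ℚ) = _
  classical
  rw [exactCounter_memory, decode_encode, listTriangles]
  congr 1
  refine triangleCount_congr ?_
  rw [← listGraph_flatMap hinput]
  simp [List.finRange_succ]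

end ExactCounter

/-! ### Random points of an affine plane -/

open Finset
open scoped BigOperators

section Resample

variable {V W : Type*} [DecidableEq V]

/-- Exchanging the value of a function at `v` with another value. -/
def exchange (v : V) : (V → W) × W ≃ (V → W) × W where
  toFun p := (Function.update p.1 v p.2, p.1 v)
  invFun p := (Function.update p.1 v p.2, p.1 v)
  left_inv p := by simp
  right_inv p := by simp

/-- Exchanging `χ v` with an independent value is a bijection of `(V → W) × W`. This serves as
conditioning on all values of `χ` except the one at `v`. -/
theorem expect_resample [Fintype V] [Fintype W] [Nonempty W] (v : V) (f : (V → W) → ℝ) :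
    𝔼 χ, f χ = 𝔼 χ, 𝔼 w, f (Function.update χ v w) := by
  have h1 : 𝔼 p : (V → W) × W, f p.1 = 𝔼 p : (V → W) × W, f (Function.update p.1 v p.2) :=
    (Fintype.expect_equiv (exchange v) _ _ fun _ => rfl).symm
  have h2 := Finset.expect_product univ univ (fun p : (V → W) × W => f p.1)
  have h3 := Finset.expect_product univ univ
    (fun p : (V → W) × W => f (Function.update p.1 v p.2))
  rw [univ_product_univ] at h2 h3
  rw [← h3, ← h1, h2]
  simp

end Resample

section Plane

variable {F : Type*} [Field F]

/-- The point `P` is on the line `y = ℓ.1 * x + ℓ.2`. -/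
def OnLine (ℓ P : F × F) : Prop := P.2 = ℓ.1 * P.1 + ℓ.2

/-- The line `ℓ` connects the points `P` and `Q`, which have different first coordinates. -/
def Connects (ℓ P Q : F × F) : Prop := P.1 ≠ Q.1 ∧ OnLine ℓ P ∧ OnLine ℓ Q

theorem Connects.symm {ℓ P Q : F × F} (h : Connects ℓ P Q) : Connects ℓ Q P :=
  ⟨h.1.symm, h.2.2, h.2.1⟩

theorem Connects.unique {ℓ ℓ' P Q : F × F} (h : Connects ℓ P Q) (h' : Connects ℓ' P Q) :
    ℓ = ℓ' := by
  obtain ⟨h1, h2, h3⟩ := h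
  obtain ⟨-, h4, h5⟩ := h'
  unfold OnLine at *
  have : (ℓ.1 - ℓ'.1) * (P.1 - Q.1) = 0 := by linear_combination h4 - h2 - h5 + h3
  rcases mul_eq_zero.1 this with h | h
  · have h6 : ℓ.1 = ℓ'.1 := sub_eq_zero.1 h
    refine Prod.ext h6 ?_
    rw [h6] at h2
    linear_combination h4 - h2
  · exact absurd (sub_eq_zero.1 h) h1

theorem exists_connects {P Q : F × F} (h : P.1 ≠ Q.1) : ∃ ℓ, Connects ℓ P Q := by
  have h' : P.1 - Q.1 ≠ 0 := sub_ne_zero.2 h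
  refine ⟨((P.2 - Q.2) / (P.1 - Q.1), P.2 - (P.2 - Q.2) / (P.1 - Q.1) * P.1), h, ?_, ?_⟩
  · simp [OnLine]
  · simp only [OnLine]
    field_simp
    ring

variable [Fintype F]

open Classical in
theorem expect_onLine (ℓ : F × F) :
    𝔼 p : F × F, (if OnLine ℓ p then (1 : ℝ) else 0) = 1 / Fintype.card F := by
  rw [Fintype.expect_eq_sum_div_card, Fintype.sum_prod_type, Fintype.card_prod]
  have h : ∀ x : F, ∑ y : F, (if OnLine ℓ (x, y) then (1 : ℝ) else 0) = 1 := fun x => by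
    rw [sum_eq_single (ℓ.1 * x + ℓ.2)] <;> simp +contextual [OnLine]
  simp only [h, sum_const, card_univ, nsmul_eq_mul, mul_one, Nat.cast_mul]
  have : (Fintype.card F : ℝ) ≠ 0 := by simp
  field_simp

open Classical in
theorem expect_ne (a : F) :
    𝔼 p : F × F, (if p.1 ≠ a then (1 : ℝ) else 0) = 1 - 1 / Fintype.card F := by
  rw [Fintype.expect_eq_sum_div_card, Fintype.sum_prod_type, Fintype.card_prod]
  have h : ∀ x : F, (if x ≠ a then (1 : ℝ) else 0) = 1 - if x = a then 1 else 0 := fun x => by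
    split_ifs <;> simp_all
  simp only [h, sum_const, card_univ, nsmul_eq_mul, ← mul_sum, sum_sub_distrib, sum_ite_eq',
    mem_univ, if_true, mul_one, Nat.cast_mul]
  have : (Fintype.card F : ℝ) ≠ 0 := by simp
  field_simp

open Classical in
-- A line has one point for each first coordinate, and two of these are excluded: `q - 2` of the `q
-- ^ 2` points remain.
theorem expect_onLine_ne (ℓ : F × F) {a b : F} (hab : a ≠ b) :
    𝔼 p : F × F, (if OnLine ℓ p ∧ p.1 ≠ a ∧ p.1 ≠ b then (1 : ℝ) else 0) =
      (Fintype.card F - 2) / (Fintype.card F : ℝ) ^ 2 := by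
  rw [Fintype.expect_eq_sum_div_card, Fintype.sum_prod_type, Fintype.card_prod]
  have h : ∀ x : F, ∑ y : F, (if OnLine ℓ (x, y) ∧ x ≠ a ∧ x ≠ b then (1 : ℝ) else 0) =
      1 - (if x = a then 1 else 0) - if x = b then 1 else 0 := fun x => by
    by_cases h1 : x = a
    · subst h1; simp [hab]
    · by_cases h2 : x = b
      · subst h2; simp [h1]
      · simp [h1, h2, OnLine]
  simp only [h, sum_sub_distrib, sum_const, card_univ, nsmul_eq_mul, sum_ite_eq', mem_univ,
    if_true, mul_one, Nat.cast_mul]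
  ring

end Plane

/-! ### First and second moments of the number of aligned triples -/

section Moments

variable {F V W : Type*} [Field F]

/-- The points of the vertices in `s` have distinct first coordinates and are on `ℓ`. -/
def Aligned (loc : W → F × F) (ℓ : F × F) (s : Finset V) (χ : V → W) : Prop :=
  ∀ u ∈ s, ∀ v ∈ s, u ≠ v → Connects ℓ (loc (χ u)) (loc (χ v))

open Classical in
/-- The indicator function of `Aligned`. -/
noncomputable def alignedInd (loc : W → F × F) (ℓ : F × F) (s : Finset V) (χ : V → W) : ℝ :=
  if Aligned loc ℓ s χ then 1 else 0

open Classical in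
/-- The indicator function of the points of a line. -/
noncomputable def lineInd (ℓ P : F × F) : ℝ := if OnLine ℓ P then 1 else 0

theorem alignedInd_nonneg (loc : W → F × F) (ℓ : F × F) (s : Finset V) (χ : V → W) :
    0 ≤ alignedInd loc ℓ s χ := by
  unfold alignedInd; split_ifs <;> simp

theorem lineInd_nonneg (ℓ P : F × F) : 0 ≤ lineInd ℓ P := by
  unfold lineInd; split_ifs <;> simp

theorem lineInd_le_one (ℓ P : F × F) : lineInd ℓ P ≤ 1 := by
  unfold lineInd; split_ifs <;> simp

theorem alignedInd_update [DecidableEq V] (loc : W → F × F) (ℓ : F × F) {s : Finset V} {c : V}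
    (hc : c ∉ s) (χ : V → W) (w : W) : alignedInd loc ℓ s (Function.update χ c w) = alignedInd loc ℓ s χ := by
  classical
  have : Aligned loc ℓ s (Function.update χ c w) ↔ Aligned loc ℓ s χ := by
    refine forall₂_congr fun u hu => forall₂_congr fun v hv => ?_
    rw [Function.update_of_ne (ne_of_mem_of_not_mem hu hc),
      Function.update_of_ne (ne_of_mem_of_not_mem hv hc)]
  simp only [alignedInd, this]

variable [Fintype F]

/-- The indicator function of the event that some line aligns `s`. -/
noncomputable def aligned (loc : W → F × F) (s : Finset V) (χ : V → W) : ℝ :=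
  ∑ ℓ, alignedInd loc ℓ s χ

theorem aligned_nonneg (loc : W → F × F) (s : Finset V) (χ : V → W) : 0 ≤ aligned loc s χ :=
  sum_nonneg fun _ _ => alignedInd_nonneg _ _ _ _

theorem sum_ite_le_one {ι : Type*} [Fintype ι] (p : ι → Prop) [DecidablePred p]
    (h : ∀ i j, p i → p j → i = j) : ∑ i, (if p i then (1 : ℝ) else 0) ≤ 1 := by
  rw [sum_boole]
  exact_mod_cast card_le_one.2 fun a ha b hb => h a b (by simpa using ha) (by simpa using hb)

/-- Two vertices of `s` already determine the line, so at most one summand is nonzero. Sets with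
fewer than two elements are vacuously aligned by every line. -/
theorem aligned_le_one (loc : W → F × F) {s : Finset V} (hs : 1 < s.card) (χ : V → W) :
    aligned loc s χ ≤ 1 := by
  classical
  obtain ⟨a, ha, c, hc, hac⟩ := one_lt_card.1 hs
  exact sum_ite_le_one _ fun ℓ ℓ' h h' => (h a ha c hc hac).unique (h' a ha c hc hac)

variable [DecidableEq V]

theorem aligned_update (loc : W → F × F) {s : Finset V} {c : V} (hc : c ∉ s)
    (χ : V → W) (w : W) : aligned loc s (Function.update χ c w) = aligned loc s χ :=
  sum_congr rfl fun _ _ => alignedInd_update loc _ hc χ w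

variable {loc : W → F × F}

/-- The probability that a random point extends a pair to an aligned triple. -/
noncomputable def extensionProb (F : Type*) [Fintype F] : ℝ :=
  (Fintype.card F - 2) / (Fintype.card F : ℝ) ^ 2

/-- The probability that three random points are aligned. -/
noncomputable def alignProb (F : Type*) [Fintype F] : ℝ :=
  extensionProb F * (1 - 1 / Fintype.card F)

theorem aligned_pair (loc : W → F × F) {a c : V} (hac : a ≠ c) (χ : V → W) :
    open Classical in
    aligned loc {a, c} χ = if (loc (χ c)).1 ≠ (loc (χ a)).1 then 1 else 0 := by
  classical
  have h0 : ∀ ℓ, Aligned loc ℓ {a, c} χ ↔ Connects ℓ (loc (χ a)) (loc (χ c)) := by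
    intro ℓ
    refine ⟨fun h => h a (by simp) c (by simp) hac, fun h u hu v hv huv => ?_⟩
    simp only [mem_insert, mem_singleton] at hu hv
    rcases hu with rfl | rfl <;> rcases hv with rfl | rfl
    · exact absurd rfl huv
    · exact h
    · exact h.symm
    · exact absurd rfl huv
  simp only [aligned, alignedInd, h0]
  split_ifs with h
  · obtain ⟨ℓ, hℓ⟩ := exists_connects (fun h' => h h'.symm : (loc (χ a)).1 ≠ (loc (χ c)).1)
    rw [sum_eq_single ℓ (fun ℓ' _ hne => if_neg fun h' => hne (h'.unique hℓ)) (by simp), if_pos hℓ]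
  · exact sum_eq_zero fun ℓ _ => if_neg fun h' => h fun h'' => h'.1 h''.symm

variable [Fintype W]

/-- The other two vertices fix the line, and the point of `c` must be on it with a third first
coordinate. If the other two are not aligned by `ℓ`, both summands for `ℓ` vanish. -/
theorem expect_aligned_update
    (hloc : ∀ g : F × F → ℝ, 𝔼 w, g (loc w) = 𝔼 p, g p) {t : Finset V} (ht : t.card = 3) {c : V}
    (hc : c ∈ t) (χ : V → W) :
    𝔼 w, aligned loc t (Function.update χ c w) =
      extensionProb F * aligned loc (t.erase c) χ := by
  classical
  obtain ⟨a, d, had, htc⟩ := card_eq_two.1 (show (t.erase c).card = 2 by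
    rw [card_erase_of_mem hc, ht])
  have hac : a ≠ c := by
    have : a ∈ t.erase c := by simp [htc]
    exact (mem_erase.1 this).1
  have hdc : d ≠ c := by
    have : d ∈ t.erase c := by simp [htc]
    exact (mem_erase.1 this).1
  have htt : t = {c, a, d} := by rw [← htc, insert_erase hc]
  unfold aligned
  rw [expect_sum_comm, mul_sum]
  refine sum_congr rfl fun ℓ _ => ?_
  by_cases h : Aligned loc ℓ (t.erase c) χ
  · have had' := h a (by simp [htc]) d (by simp [htc]) had
    rw [alignedInd, if_pos h, mul_one, extensionProb,
      ← expect_onLine_ne ℓ had'.1, ← hloc]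
    refine expect_congr rfl fun w _ => ?_
    rw [alignedInd]
    refine if_congr ?_ rfl rfl
    constructor
    · intro h'
      have h1 := h' c (by simp [htt]) a (by simp [htt]) hac.symm
      have h2 := h' c (by simp [htt]) d (by simp [htt]) hdc.symm
      simp only [Function.update_self, Function.update_of_ne hac,
        Function.update_of_ne hdc] at h1 h2
      exact ⟨h1.2.1, h1.1, h2.1⟩
    · rintro ⟨h1, h2, h3⟩ u hu v hv huv
      have key : ∀ x ∈ t, x ≠ c → Connects ℓ (loc w) (loc (χ x)) := by
        intro x hx hxc
        rw [htt] at hx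
        simp only [mem_insert, mem_singleton, hxc, false_or] at hx
        rcases hx with rfl | rfl
        · exact ⟨h2, h1, had'.2.1⟩
        · exact ⟨h3, h1, had'.2.2⟩
      by_cases huc : u = c
      · subst huc
        rw [Function.update_self, Function.update_of_ne huv.symm]
        exact key v hv huv.symm
      · by_cases hvc : v = c
        · subst hvc
          rw [Function.update_self, Function.update_of_ne huv]
          exact (key u hu huv).symm
        · rw [Function.update_of_ne huc, Function.update_of_ne hvc]
          exact h u (by simp [huc, hu]) v (by simp [hvc, hv]) huv
  · rw [alignedInd, if_neg h, mul_zero]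
    refine (expect_congr rfl fun w _ => ?_).trans (expect_const_zero _)
    rw [alignedInd, if_neg]
    intro h'
    refine h fun u hu v hv huv => ?_
    have := h' u (mem_of_mem_erase hu) v (mem_of_mem_erase hv) huv
    rwa [Function.update_of_ne (ne_of_mem_erase hu),
      Function.update_of_ne (ne_of_mem_erase hv)] at this

variable [Fintype V] [Nonempty W]

theorem expect_aligned_pair
    (hloc : ∀ g : F × F → ℝ, 𝔼 w, g (loc w) = 𝔼 p, g p) {a c : V} (hac : a ≠ c) :
    𝔼 χ : V → W, aligned loc {a, c} χ = 1 - 1 / Fintype.card F := by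
  classical
  rw [expect_resample c]
  have : ∀ χ : V → W, 𝔼 w, aligned loc {a, c} (Function.update χ c w) =
      1 - 1 / Fintype.card F := by
    intro χ
    simp only [aligned_pair loc hac, Function.update_self, Function.update_of_ne hac]
    rw [← expect_ne (loc (χ a)).1, ← hloc]
  simp only [this, Fintype.expect_const]

theorem expect_aligned (hloc : ∀ g : F × F → ℝ, 𝔼 w, g (loc w) = 𝔼 p, g p) {t : Finset V}
    (ht : t.card = 3) : 𝔼 χ : V → W, aligned loc t χ = alignProb F := by
  obtain ⟨c, hc⟩ : t.Nonempty := card_pos.1 (by omega)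
  obtain ⟨a, d, had, htc⟩ := card_eq_two.1 (show (t.erase c).card = 2 by
    rw [card_erase_of_mem hc, ht])
  rw [expect_resample c]
  simp only [expect_aligned_update hloc ht hc]
  rw [← mul_expect, htc, expect_aligned_pair hloc had, alignProb]

/-- Resample a vertex `c` of `t'` outside `t`: the first factor does not change, and the second
averages to `extensionProb F` times an indicator, which is bounded by `1`. The triples may share two
vertices. -/
theorem expect_aligned_mul_le (hloc : ∀ g : F × F → ℝ, 𝔼 w, g (loc w) = 𝔼 p, g p)
    (hF : 2 ≤ Fintype.card F) {t t' : Finset V}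
    (ht : t.card = 3) (ht' : t'.card = 3) (htt : t ≠ t') :
    𝔼 χ : V → W, aligned loc t χ * aligned loc t' χ ≤ extensionProb F * alignProb F := by
  obtain ⟨c, hc, hct⟩ : ∃ c ∈ t', c ∉ t := by
    by_contra! h
    exact htt (eq_of_subset_of_card_le h (by omega)).symm
  rw [expect_resample c, ← expect_aligned hloc ht, mul_expect]
  refine expect_le_expect fun χ _ => ?_
  simp only [aligned_update loc hct]
  rw [← mul_expect, expect_aligned_update hloc ht' hc]
  have h0 : 0 ≤ extensionProb F :=
    div_nonneg (sub_nonneg.2 (by exact_mod_cast hF)) (by positivity)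
  have h1 := aligned_le_one loc (s := t'.erase c) (by rw [card_erase_of_mem hc, ht']; norm_num) χ
  have h2 := mul_nonneg h0 (aligned_nonneg loc t χ)
  nlinarith

theorem expect_sq_le (hloc : ∀ g : F × F → ℝ, 𝔼 w, g (loc w) = 𝔼 p, g p)
    (hF : 2 ≤ Fintype.card F) (T : Finset (Finset V)) (hT : ∀ t ∈ T, t.card = 3) :
    𝔼 χ : V → W, (∑ t ∈ T, aligned loc t χ - alignProb F * T.card) ^ 2 ≤
      alignProb F * T.card + (alignProb F * T.card) ^ 2 / (Fintype.card F - 1) := by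
  have hq : (2 : ℝ) ≤ Fintype.card F := by exact_mod_cast hF
  have hα : 0 ≤ extensionProb F := div_nonneg (sub_nonneg.2 hq) (by positivity)
  have hπ : 0 ≤ alignProb F := mul_nonneg hα (by
    rw [sub_nonneg, div_le_one (by linarith)]; linarith)
  have h1 : 𝔼 χ : V → W, ∑ t ∈ T, aligned loc t χ = alignProb F * T.card := by
    rw [expect_sum_comm, sum_congr rfl fun t ht => expect_aligned hloc (hT t ht), sum_const,
      nsmul_eq_mul, mul_comm]
  have h2 : 𝔼 χ : V → W, (∑ t ∈ T, aligned loc t χ) ^ 2 ≤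
      T.card * alignProb F + T.card ^ 2 * (extensionProb F * alignProb F) := by
    simp only [sq (∑ t ∈ T, aligned loc t _), sum_mul_sum]
    rw [expect_sum_comm]
    simp only [expect_sum_comm]
    calc ∑ t ∈ T, ∑ t' ∈ T, 𝔼 χ : V → W, aligned loc t χ * aligned loc t' χ
        ≤ ∑ t ∈ T, ∑ t' ∈ T, ((if t = t' then alignProb F else 0) +
            extensionProb F * alignProb F) := by
          refine sum_le_sum fun t ht => sum_le_sum fun t' ht' => ?_
          split_ifs with h
          · subst h
            refine le_add_of_le_of_nonneg ?_ (mul_nonneg hα hπ)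
            rw [← expect_aligned hloc (hT t ht)]
            refine expect_le_expect fun χ _ => ?_
            have := aligned_le_one loc (s := t) (by rw [hT t ht]; norm_num) χ
            have := aligned_nonneg loc t χ
            nlinarith
          · rw [zero_add]
            exact expect_aligned_mul_le hloc hF (hT t ht) (hT t' ht') h
      _ = _ := by
          simp only [sum_add_distrib, sum_ite_eq, sum_const, nsmul_eq_mul]
          rw [sum_congr rfl fun t ht => if_pos ht]
          simp only [sum_const, nsmul_eq_mul]
          ring
  have h3 : 𝔼 χ : V → W, (∑ t ∈ T, aligned loc t χ - alignProb F * T.card) ^ 2 =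
      𝔼 χ : V → W, (∑ t ∈ T, aligned loc t χ) ^ 2 - (alignProb F * T.card) ^ 2 := by
    have : ∀ χ : V → W, (∑ t ∈ T, aligned loc t χ - alignProb F * T.card) ^ 2 =
        (∑ t ∈ T, aligned loc t χ) ^ 2 - (2 * (alignProb F * T.card)) * ∑ t ∈ T, aligned loc t χ +
          (alignProb F * T.card) ^ 2 := fun χ => by ring
    simp only [this]
    rw [expect_add_distrib, expect_sub_distrib, ← mul_expect, h1, Fintype.expect_const]
    ring
  rw [h3]
  -- Since `alignProb` is `extensionProb` times `(q - 1) / q`, the covariances exceed `0` only by a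
  -- factor `1 / (q - 1)` of the squared probability.
  have h4 : extensionProb F * alignProb F = alignProb F ^ 2 + alignProb F ^ 2 /
      (Fintype.card F - 1) := by
    have : (Fintype.card F : ℝ) - 1 ≠ 0 := by linarith
    rw [alignProb]
    have : (Fintype.card F : ℝ) ≠ 0 := by linarith
    field_simp
    ring
  rw [h4] at h2
  refine (sub_le_sub_right h2 _).trans (le_of_eq ?_)
  ring

/-- Triples, pairs and lines: a further vertex is on the line of an aligned triple with the
probability `1 / card F`, unless it belongs to the triple. -/
theorem expect_mul_lineInd_le (hloc : ∀ g : F × F → ℝ, 𝔼 w, g (loc w) = 𝔼 p, g p)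
    (f : F × F → (V → W) → ℝ) (hf : ∀ ℓ χ, 0 ≤ f ℓ χ) (t : Finset V) (u : V)
    (hu : u ∉ t → ∀ ℓ χ w, f ℓ (Function.update χ u w) = f ℓ χ) :
    𝔼 χ, ∑ ℓ, f ℓ χ * lineInd ℓ (loc (χ u)) ≤
      (if u ∈ t then 1 else 1 / (Fintype.card F : ℝ)) * 𝔼 χ, ∑ ℓ, f ℓ χ := by
  classical
  split_ifs with h
  · rw [one_mul]
    exact expect_le_expect fun χ _ => sum_le_sum fun ℓ _ =>
      mul_le_of_le_one_right (hf ℓ χ) (lineInd_le_one _ _)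
  · rw [expect_resample u, mul_expect]
    refine (expect_congr rfl fun χ _ => ?_).le
    rw [expect_sum_comm, mul_sum]
    refine sum_congr rfl fun ℓ _ => ?_
    simp only [hu h, Function.update_self]
    rw [← mul_expect, hloc (fun p => lineInd ℓ p)]
    simp only [lineInd]
    rw [expect_onLine, mul_comm]

/-- Apply `expect_mul_lineInd_le` to `u` and then to `v`. Each vertex outside the triple contributes
an independent factor `1 / q`; one inside contributes only the trivial bound `1`. -/
theorem expect_aligned_lineInd_le (hloc : ∀ g : F × F → ℝ, 𝔼 w, g (loc w) = 𝔼 p, g p)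
    {t : Finset V} (ht : t.card = 3) {u v : V} (huv : u ≠ v) :
    𝔼 χ : V → W, ∑ ℓ, alignedInd loc ℓ t χ * lineInd ℓ (loc (χ v)) * lineInd ℓ (loc (χ u)) ≤
      alignProb F * ((if u ∈ t then 1 else 1 / (Fintype.card F : ℝ)) *
        (if v ∈ t then 1 else 1 / (Fintype.card F : ℝ))) := by
  refine (expect_mul_lineInd_le hloc
    (fun ℓ χ => alignedInd loc ℓ t χ * lineInd ℓ (loc (χ v)))
    (fun ℓ χ => mul_nonneg (alignedInd_nonneg _ _ _ _) (lineInd_nonneg _ _)) t u ?_).trans ?_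
  · intro hu ℓ χ w
    rw [alignedInd_update loc ℓ hu, Function.update_of_ne huv.symm]
  · rw [mul_comm (alignProb F), mul_assoc]
    refine mul_le_mul_of_nonneg_left ?_ (by positivity)
    rw [← expect_aligned hloc ht]
    exact expect_mul_lineInd_le hloc (fun ℓ χ => alignedInd loc ℓ t χ)
      (fun ℓ χ => alignedInd_nonneg _ _ _ _) t v
      (fun hv ℓ χ w => alignedInd_update loc ℓ hv χ w)

end Moments

/-! ### A single repetition -/

/-- Pointwise form of the Chebyshev and Markov inequalities. If `Z / p` is inaccurate, then either
`X` differs from its mean by at least half of the tolerance, or the loss `X - Z` uses up half of it;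
either case makes one summand at least `1`. -/
theorem one_le_of_deviation {e p T τ X Z L : ℝ} (he : 0 < e) (hp : 0 < p) (hτ : 0 < τ)
    (hμ : 0 < p * T) (hL : 0 ≤ L) (hZ : Z ≤ X) (hlost : X - Z ≤ L / τ)
    (h : e * T < |Z / p - T|) :
    1 ≤ (X - p * T) ^ 2 * (4 / (e * (p * T)) ^ 2) + L * (2 / (e * (p * T) * τ)) := by
  have h' : e * (p * T) < |Z - p * T| := by
    have h5 : Z - p * T = p * (Z / p - T) := by field_simp
    rw [h5, abs_mul, abs_of_pos hp]
    nlinarith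
  generalize p * T = μ at *
  by_cases h6 : e * μ / 2 ≤ |X - μ|
  · refine le_add_of_le_of_nonneg ?_ (by positivity)
    rw [← sq_abs, ← mul_div_assoc, le_div_iff₀ (by positivity)]
    have := pow_le_pow_left₀ (by positivity) h6 2
    nlinarith
  · refine le_add_of_nonneg_of_le (by positivity) ?_
    rw [← mul_div_assoc, le_div_iff₀ (by positivity)]
    rw [le_div_iff₀ hτ] at hlost
    have h7 : e * μ / 2 ≤ X - Z := by
      have := abs_sub_abs_le_abs_sub (Z - μ) (X - μ)
      rw [sub_sub_sub_cancel_right, abs_sub_comm Z X, abs_of_nonneg (sub_nonneg.2 hZ)] at this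
      linarith
    nlinarith

/-- The two parts of the variance and the expected loss contribute at most `1 / 48` each. -/
theorem cost_le {e μ q τ A B : ℝ} (he : 0 < e) (hτ : 0 < τ) (hμ : 192 / e ^ 2 ≤ μ) (hq0 : 0 < q)
    (hq : 192 / e ^ 2 ≤ q) (hA : A ≤ μ + μ ^ 2 / q) (hB : B ≤ μ * (e * τ / 96)) :
    A * (4 / (e * μ) ^ 2) + B * (2 / (e * μ * τ)) ≤ 1 / 16 := by
  have hμ0 : 0 < μ := lt_of_lt_of_le (by positivity) hμ
  have h5 : A * (4 / (e * μ) ^ 2) ≤ 1 / 24 := by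
    refine (mul_le_mul_of_nonneg_right hA (by positivity)).trans ?_
    have e1 : (μ + μ ^ 2 / q) * (4 / (e * μ) ^ 2) = 4 / e ^ 2 * (1 / μ) + 4 / e ^ 2 * (1 / q) := by
      field_simp
    have e2 : ∀ y : ℝ, 0 < y → 192 / e ^ 2 ≤ y → 4 / e ^ 2 * (1 / y) ≤ 1 / 48 := by
      intro y hy hy'
      rw [mul_one_div, div_le_iff₀ hy]
      have : 4 / e ^ 2 = 1 / 48 * (192 / e ^ 2) := by ring
      rw [this]
      linarith
    rw [e1]
    linarith [e2 μ hμ0 hμ, e2 _ hq0 hq]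
  have h6 : B * (2 / (e * μ * τ)) ≤ 1 / 48 := by
    refine (mul_le_mul_of_nonneg_right hB (by positivity)).trans (le_of_eq ?_)
    field_simp
    norm_num
  linarith

section Repetition

variable {F W : Type*} [Field F] {n : ℕ} (G : SimpleGraph (Fin n))
  [DecidableRel G.Adj] (loc : W → F × F)

/-- The pairs of vertices that are connected by the line `ℓ`. -/
def lineSel (ℓ : F × F) (χ : Fin n → W) (u v : Fin n) : Prop :=
  Connects ℓ (loc (χ u)) (loc (χ v))

open Classical in
theorem triangleCount_lineSel (ℓ : F × F) (χ : Fin n → W) :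
    (triangleCount (selGraph G (lineSel loc ℓ χ)) : ℝ) =
      ∑ t ∈ G.cliqueFinset 3, alignedInd loc ℓ t χ := by
  unfold alignedInd
  rw [sum_boole, triangleCount]
  congr 2
  ext t
  simp only [SimpleGraph.mem_cliqueFinset_iff, mem_filter, SimpleGraph.isNClique_iff,
    SimpleGraph.isClique_iff, Set.Pairwise, mem_coe]
  constructor
  · rintro ⟨h, hc⟩
    exact ⟨⟨fun u hu v hv huv => (h hu hv huv).1, hc⟩, fun u hu v hv huv => (h hu hv huv).2.1⟩
  · rintro ⟨⟨h, hc⟩, h'⟩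
    exact ⟨fun u hu v hv huv => ⟨h hu hv huv, h' u hu v hv huv, h' v hv u hu huv.symm⟩, hc⟩

open Classical in
-- Ordered pairs count every edge twice. Dropping the condition on first coordinates leaves a
-- product of two point indicators, whose expectation is easy to bound.
theorem card_edgeFinset_lineSel_le (ℓ : F × F) (χ : Fin n → W) :
    2 * ((selGraph G (lineSel loc ℓ χ)).edgeFinset.card : ℝ) ≤
      ∑ u, ∑ v, if G.Adj u v then lineInd ℓ (loc (χ v)) * lineInd ℓ (loc (χ u)) else 0 := by
  have h := (selGraph G (lineSel loc ℓ χ)).sum_degrees_eq_twice_card_edges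
  have h' : 2 * ((selGraph G (lineSel loc ℓ χ)).edgeFinset.card : ℝ) =
      ∑ u, ((selGraph G (lineSel loc ℓ χ)).degree u : ℝ) := by
    exact_mod_cast h.symm
  rw [h']
  refine sum_le_sum fun u _ => ?_
  rw [← SimpleGraph.card_neighborFinset_eq_degree, SimpleGraph.neighborFinset_eq_filter,
    ← sum_boole]
  refine sum_le_sum fun v _ => ?_
  by_cases h1 : (selGraph G (lineSel loc ℓ χ)).Adj u v
  · rw [if_pos h1, if_pos h1.1, lineInd, lineInd, if_pos h1.2.1.2.1, if_pos h1.2.1.2.2]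
    simp
  · rw [if_neg h1]
    split_ifs
    · exact mul_nonneg (lineInd_nonneg _ _) (lineInd_nonneg _ _)
    · exact le_rfl

theorem sum_adj (G : SimpleGraph (Fin n)) [DecidableRel G.Adj] :
    ∑ u, ∑ v, (if G.Adj u v then (1 : ℝ) else 0) = 2 * G.edgeFinset.card := by
  have h := G.sum_degrees_eq_twice_card_edges
  have h' : (2 * G.edgeFinset.card : ℝ) = ∑ u, (G.degree u : ℝ) := by
    exact_mod_cast h.symm
  rw [h']
  refine sum_congr rfl fun u _ => ?_
  rw [← SimpleGraph.card_neighborFinset_eq_degree, SimpleGraph.neighborFinset_eq_filter,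
    ← sum_boole]

/-- Adjacency matters only for the term `x ^ 2`; pairs that meet `t` are bounded by all pairs with
one vertex in `t`. -/
theorem sum_weights_le {x : ℝ} (hx : 0 ≤ x) (t : Finset (Fin n)) (ht : t.card = 3) :
    ∑ u, ∑ v, (if G.Adj u v then (if u ∈ t then 1 else x) * (if v ∈ t then 1 else x) else 0) ≤
      2 * (G.edgeFinset.card * x ^ 2 + 9 + 3 * n * x) := by
  have hw : ∀ u, 0 ≤ (if u ∈ t then 1 else x) := fun u => by split_ifs <;> simp [hx]
  have hsum : ∑ v, (if v ∈ t then 1 else x) ≤ 3 + n * x := by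
    calc ∑ v, (if v ∈ t then 1 else x) ≤ ∑ v : Fin n, ((if v ∈ t then 1 else 0) + x) := by
          refine sum_le_sum fun v _ => ?_
          split_ifs <;> simp [hx]
      _ = _ := by
          rw [sum_add_distrib, sum_boole, filter_mem_eq_inter, univ_inter, ht]
          simp
  have h3 : ∑ u : Fin n, (if u ∈ t then (1 : ℝ) else 0) = 3 := by
    rw [sum_boole, filter_mem_eq_inter, univ_inter, ht]
    norm_num
  calc _ ≤ ∑ u, ∑ v, (x ^ 2 * (if G.Adj u v then 1 else 0) +
        (if u ∈ t then 1 else 0) * (if v ∈ t then 1 else x) +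
        (if v ∈ t then 1 else 0) * (if u ∈ t then 1 else x)) := by
        refine sum_le_sum fun u _ => sum_le_sum fun v _ => ?_
        have := hw u
        have := hw v
        split_ifs <;> nlinarith
    _ = x ^ 2 * (2 * G.edgeFinset.card) + 3 * ∑ v, (if v ∈ t then 1 else x) +
        3 * ∑ v, (if v ∈ t then 1 else x) := by
        simp only [sum_add_distrib, ← mul_sum, ← sum_mul, sum_adj, h3]
    _ ≤ _ := by nlinarith

variable [Fintype F]

/-- The number of triangles counted by the machines of one repetition. -/
noncomputable def counted (τ : ℕ) (χ : Fin n → W) : ℕ :=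
  ∑ ℓ, cappedTriangles G τ (lineSel loc ℓ χ)

theorem sum_triangleCount_lineSel (χ : Fin n → W) :
    open Classical in
    ∑ ℓ, (triangleCount (selGraph G (lineSel loc ℓ χ)) : ℝ) =
      ∑ t ∈ G.cliqueFinset 3, aligned loc t χ := by
  simp only [triangleCount_lineSel, aligned]
  exact sum_comm

open Classical in
/-- The triangles that are lost because machines are overloaded. -/
theorem sub_counted_le {τ : ℕ} (hτ : 0 < τ) (χ : Fin n → W) :
    ∑ t ∈ G.cliqueFinset 3, aligned loc t χ - counted G loc τ χ ≤
      (∑ ℓ, (triangleCount (selGraph G (lineSel loc ℓ χ)) : ℝ) *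
        (selGraph G (lineSel loc ℓ χ)).edgeFinset.card) / τ := by
  rw [← sum_triangleCount_lineSel, counted, Nat.cast_sum, ← sum_sub_distrib, sum_div]
  refine sum_le_sum fun ℓ _ => ?_
  have hτ' : (0 : ℝ) < τ := by exact_mod_cast hτ
  rw [cappedTriangles]
  split_ifs with h
  · rw [sub_self]
    positivity
  -- An overloaded line has more than `τ` edges, so each of its lost triangles is charged more than
  -- `1` on the right.
  · rw [Nat.cast_zero, sub_zero, le_div_iff₀ hτ']
    refine mul_le_mul_of_nonneg_left ?_ (by positivity)
    exact_mod_cast (not_le.1 h).le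

theorem counted_le (τ : ℕ) (χ : Fin n → W) :
    (counted G loc τ χ : ℝ) ≤ ∑ t ∈ G.cliqueFinset 3, aligned loc t χ := by
  classical
  rw [← sum_triangleCount_lineSel, counted, Nat.cast_sum]
  refine sum_le_sum fun ℓ _ => ?_
  rw [cappedTriangles]
  split_ifs
  · exact le_rfl
  · rw [Nat.cast_zero]
    positivity

variable [Fintype W] [Nonempty W]

open Classical in
-- By linearity it suffices to bound, for each triangle and each ordered adjacent pair, the
-- probability that one line aligns the triangle and contains both points of the pair.
theorem expect_load_le {loc : W → F × F}
    (hloc : ∀ g : F × F → ℝ, 𝔼 w, g (loc w) = 𝔼 p, g p)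
    (hF : 2 ≤ Fintype.card F) :
    𝔼 χ : Fin n → W, ∑ ℓ, (triangleCount (selGraph G (lineSel loc ℓ χ)) : ℝ) *
        (selGraph G (lineSel loc ℓ χ)).edgeFinset.card ≤
      alignProb F * triangleCount G * (G.edgeFinset.card * (1 / (Fintype.card F : ℝ)) ^ 2 + 9 +
        3 * n * (1 / (Fintype.card F : ℝ))) := by
  have hq : (2 : ℝ) ≤ Fintype.card F := by exact_mod_cast hF
  have hπ : 0 ≤ alignProb F := mul_nonneg (div_nonneg (sub_nonneg.2 hq) (by positivity)) (by
    rw [sub_nonneg, div_le_one (by linarith)]; linarith)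
  calc _ ≤ 𝔼 χ : Fin n → W, ∑ ℓ, (∑ t ∈ G.cliqueFinset 3, alignedInd loc ℓ t χ) *
        ((∑ u, ∑ v, if G.Adj u v then lineInd ℓ (loc (χ v)) * lineInd ℓ (loc (χ u)) else 0) / 2) :=
        expect_le_expect fun χ _ => sum_le_sum fun ℓ _ => by
          rw [triangleCount_lineSel]
          refine mul_le_mul_of_nonneg_left ?_ (sum_nonneg fun t _ => alignedInd_nonneg _ _ _ _)
          linarith [card_edgeFinset_lineSel_le G loc ℓ χ]
    _ = 𝔼 χ : Fin n → W, ∑ t ∈ G.cliqueFinset 3, ∑ u, ∑ v, if G.Adj u v then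
          (∑ ℓ, alignedInd loc ℓ t χ * lineInd ℓ (loc (χ v)) * lineInd ℓ (loc (χ u))) / 2
          else 0 := by
        refine expect_congr rfl fun χ _ => ?_
        have : ∀ ℓ, (∑ t ∈ G.cliqueFinset 3, alignedInd loc ℓ t χ) *
            ((∑ u, ∑ v, if G.Adj u v then lineInd ℓ (loc (χ v)) * lineInd ℓ (loc (χ u)) else 0) / 2)
            = ∑ t ∈ G.cliqueFinset 3, ∑ u, ∑ v, if G.Adj u v then
              alignedInd loc ℓ t χ * lineInd ℓ (loc (χ v)) * lineInd ℓ (loc (χ u)) / 2 else 0 := by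
          intro ℓ
          rw [sum_mul]
          refine sum_congr rfl fun t _ => ?_
          rw [sum_div, mul_sum]
          refine sum_congr rfl fun u _ => ?_
          rw [sum_div, mul_sum]
          refine sum_congr rfl fun v _ => ?_
          split_ifs
          · ring
          · ring
        simp only [this]
        rw [sum_comm]
        refine sum_congr rfl fun t _ => ?_
        rw [sum_comm]
        refine sum_congr rfl fun u _ => ?_
        rw [sum_comm]
        refine sum_congr rfl fun v _ => ?_
        split_ifs
        · rw [sum_div]
        · simp
    _ = ∑ t ∈ G.cliqueFinset 3, ∑ u, ∑ v, if G.Adj u v then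
          (𝔼 χ : Fin n → W, ∑ ℓ, alignedInd loc ℓ t χ * lineInd ℓ (loc (χ v)) *
            lineInd ℓ (loc (χ u))) / 2 else 0 := by
        simp only [expect_sum_comm _ _ (fun (χ : Fin n → W) (i : Finset (Fin n)) => _),
          expect_sum_comm _ _ (fun (χ : Fin n → W) (i : Fin n) => _)]
        refine sum_congr rfl fun t _ => sum_congr rfl fun u _ => sum_congr rfl fun v _ => ?_
        split_ifs
        · rw [expect_div]
        · simp
    _ ≤ ∑ t ∈ G.cliqueFinset 3, ∑ u, ∑ v, alignProb F / 2 * if G.Adj u v then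
          (if u ∈ t then 1 else 1 / (Fintype.card F : ℝ)) *
            (if v ∈ t then 1 else 1 / (Fintype.card F : ℝ)) else 0 := by
        refine sum_le_sum fun t ht => sum_le_sum fun u _ => sum_le_sum fun v _ => ?_
        by_cases h : G.Adj u v
        · rw [if_pos h, if_pos h]
          have := expect_aligned_lineInd_le hloc
            (SimpleGraph.mem_cliqueFinset_iff.1 ht).card_eq h.ne
          linarith
        · rw [if_neg h, if_neg h, mul_zero]
    _ ≤ ∑ t ∈ G.cliqueFinset 3, alignProb F / 2 *
          (2 * (G.edgeFinset.card * (1 / (Fintype.card F : ℝ)) ^ 2 + 9 +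
            3 * n * (1 / (Fintype.card F : ℝ)))) := by
        refine sum_le_sum fun t ht => ?_
        simp only [← mul_sum]
        exact mul_le_mul_of_nonneg_left (sum_weights_le G (by positivity) t
          (SimpleGraph.mem_cliqueFinset_iff.1 ht).card_eq) (by linarith)
    _ = _ := by
        rw [sum_const, nsmul_eq_mul, triangleCount]
        ring

open Classical in
theorem card_bad_le {loc : W → F × F}
    (hloc : ∀ g : F × F → ℝ, 𝔼 w, g (loc w) = 𝔼 p, g p)
    (hF : 4 ≤ Fintype.card F) {e : ℝ} (he : 0 < e) {τ : ℕ} (hτ : 0 < τ)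
    (h1 : 192 / e ^ 2 ≤ alignProb F * triangleCount G)
    (h2 : 192 / e ^ 2 ≤ Fintype.card F - 1)
    (h3 : 96 * (G.edgeFinset.card * (1 / (Fintype.card F : ℝ)) ^ 2 + 9 +
        3 * n * (1 / (Fintype.card F : ℝ))) ≤ e * τ) :
    16 * #{χ : Fin n → W | e * triangleCount G <
      |(counted G loc τ χ : ℝ) / alignProb F - triangleCount G|} ≤ Fintype.card (Fin n → W) := by
  set bad : Finset (Fin n → W) := {χ | e * triangleCount G <
      |(counted G loc τ χ : ℝ) / alignProb F - triangleCount G|}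
  have hq : (4 : ℝ) ≤ Fintype.card F := by exact_mod_cast hF
  have hπ : 0 < alignProb F := mul_pos (div_pos (by linarith) (by positivity)) (by
    rw [sub_pos, div_lt_one (by linarith)]; linarith)
  have hτ' : (0 : ℝ) < τ := by exact_mod_cast hτ
  set T : ℝ := (triangleCount G : ℝ) with hT
  set μ := alignProb F * T with hμ
  have hμ0 : 0 < μ := lt_of_lt_of_le (by positivity) h1
  set X : (Fin n → W) → ℝ := fun χ => ∑ t ∈ G.cliqueFinset 3, aligned loc t χ
  set L : (Fin n → W) → ℝ := fun χ => ∑ ℓ, (triangleCount (selGraph G (lineSel loc ℓ χ)) : ℝ) *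
        (selGraph G (lineSel loc ℓ χ)).edgeFinset.card
  have hvar : 𝔼 χ, (X χ - μ) ^ 2 ≤ μ + μ ^ 2 / (Fintype.card F - 1) :=
    expect_sq_le hloc (by omega) (G.cliqueFinset 3)
      (fun t ht => (SimpleGraph.mem_cliqueFinset_iff.1 ht).card_eq)
  have hload : 𝔼 χ, L χ ≤ μ * (e * τ / 96) := by
    refine (expect_load_le G hloc (by omega)).trans ?_
    refine mul_le_mul_of_nonneg_left ?_ hμ0.le
    linarith
  have hL0 : ∀ χ, 0 ≤ L χ := fun χ => sum_nonneg fun ℓ _ => by positivity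
  have hX : ∀ χ, (counted G loc τ χ : ℝ) ≤ X χ := counted_le G loc τ
  have hlost : ∀ χ, X χ - counted G loc τ χ ≤ L χ / τ := sub_counted_le G loc hτ
  have hbad : ∀ χ, χ ∈ bad → e * T < |(counted G loc τ χ : ℝ) / alignProb F - T| :=
    fun χ hχ => (mem_filter.1 hχ).2
  clear_value X L bad
  have hpoint : ∀ χ, (if χ ∈ bad then (1 : ℝ) else 0) ≤
      (X χ - μ) ^ 2 * (4 / (e * μ) ^ 2) + L χ * (2 / (e * μ * τ)) := by
    intro χ
    split_ifs with h
    · exact one_le_of_deviation he hπ hτ' hμ0 (hL0 χ) (hX χ) (hlost χ) (hbad χ h)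
    · have := hL0 χ
      positivity
  have hE : 𝔼 χ, (if χ ∈ bad then (1 : ℝ) else 0) ≤ 1 / 16 := by
    refine (expect_le_expect fun χ _ => hpoint χ).trans ?_
    rw [expect_add_distrib, ← expect_mul, ← expect_mul]
    exact cost_le he hτ' h1 (by linarith) h2 hvar hload
  rw [Fintype.expect_eq_sum_div_card, sum_boole, div_le_iff₀ (by positivity)] at hE
  rw [filter_mem_eq_inter, univ_inter] at hE
  have : (16 * #bad : ℝ) ≤ Fintype.card (Fin n → W) := by linarith
  exact_mod_cast this

end Repetition

/-! ### Independent repetitions -/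

/-- Union bound over the at most `2 ^ r` sets `B` of at least `r / 2` repetitions: all those in `B`
fail with probability at most `16 ^ (-r / 2) = 4 ^ (-r)`. -/
theorem card_majority_bad {Ω : Type*} [Fintype Ω] [DecidableEq Ω] (bad : Finset Ω)
    (h : 16 * #bad ≤ Fintype.card Ω) (r : ℕ) :
    2 ^ r * #{χ : Fin r → Ω | r ≤ 2 * #{ρ | χ ρ ∈ bad}} ≤ Fintype.card Ω ^ r := by
  have hcard : ∀ B : Finset (Fin r), r ≤ 2 * #B →
      4 ^ r * #(Fintype.piFinset fun ρ => if ρ ∈ B then bad else univ) ≤ Fintype.card Ω ^ r := by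
    intro B hB
    have hBr : #B ≤ r := by simpa using card_le_univ B
    rw [Fintype.card_piFinset]
    simp only [apply_ite Finset.card, card_univ]
    rw [prod_ite, prod_const, prod_const, filter_mem_eq_inter, univ_inter,
      filter_not, filter_mem_eq_inter, univ_inter, card_sdiff_of_subset (subset_univ B), card_univ,
      Fintype.card_fin]
    calc 4 ^ r * (#bad ^ #B * Fintype.card Ω ^ (r - #B))
        ≤ 4 ^ (2 * #B) * (#bad ^ #B * Fintype.card Ω ^ (r - #B)) := by
          gcongr
          norm_num
      _ = (16 * #bad) ^ #B * Fintype.card Ω ^ (r - #B) := by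
          rw [pow_mul, mul_pow]
          norm_num
          ring
      _ ≤ Fintype.card Ω ^ #B * Fintype.card Ω ^ (r - #B) := by gcongr
      _ = Fintype.card Ω ^ r := by rw [← pow_add, Nat.add_sub_cancel' hBr]
  have hsub : ({χ : Fin r → Ω | r ≤ 2 * #{ρ | χ ρ ∈ bad}} : Finset (Fin r → Ω)) ⊆
      ({B : Finset (Fin r) | r ≤ 2 * #B} : Finset _).biUnion
        fun B => Fintype.piFinset fun ρ => if ρ ∈ B then bad else univ := by
    intro χ hχ
    rw [mem_filter] at hχ
    rw [mem_biUnion]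
    refine ⟨univ.filter fun ρ => χ ρ ∈ bad, by simpa using hχ.2, ?_⟩
    rw [Fintype.mem_piFinset]
    intro ρ
    split_ifs with h
    · simpa using h
    · exact mem_univ _
  have h4 : 4 ^ r * #{χ : Fin r → Ω | r ≤ 2 * #{ρ | χ ρ ∈ bad}} ≤
      2 ^ r * Fintype.card Ω ^ r := by
    calc _ ≤ 4 ^ r * ∑ B : Finset (Fin r) with r ≤ 2 * #B,
          #(Fintype.piFinset fun ρ => if ρ ∈ B then bad else univ) := by
          gcongr
          exact (card_le_card hsub).trans card_biUnion_le
      _ ≤ ∑ B : Finset (Fin r) with r ≤ 2 * #B, Fintype.card Ω ^ r := by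
          rw [mul_sum]
          exact sum_le_sum fun B hB => hcard B (mem_filter.1 hB).2
      _ ≤ _ := by
          rw [sum_const, smul_eq_mul]
          gcongr
          refine (card_le_univ _).trans ?_
          simp
  have h5 : (4 : ℕ) ^ r = 2 ^ r * 2 ^ r := by rw [← mul_pow]; norm_num
  rw [h5, mul_assoc] at h4
  exact Nat.le_of_mul_le_mul_left h4 (by positivity)

open Classical in
/-- Restricting a uniformly random function along an injection gives a uniformly random
function. -/
theorem card_comp_mem {A B W : Type*} [Fintype A] [Fintype B] [Fintype W]
    [DecidableEq A] [DecidableEq B] (f : A → B)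
    (hf : Function.Injective f) (E : Finset (A → W)) :
    #{ω : B → W | ω ∘ f ∈ E} * Fintype.card (A → W) = #E * Fintype.card (B → W) := by
  let e : (B → W) ≃ (A → W) × ({b : B // b ∉ Set.range f} → W) :=
    (Equiv.piEquivPiSubtypeProd (· ∈ Set.range f) (fun _ => W)).trans
      (Equiv.prodCongr (Equiv.arrowCongr (Equiv.ofInjective f hf).symm (Equiv.refl W))
        (Equiv.refl _))
  have he : ∀ ω, (e ω).1 = ω ∘ f := fun ω => by
    funext a
    simp [e]
  have h1 : #{ω : B → W | ω ∘ f ∈ E} =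
      #(E ×ˢ (univ : Finset ({b : B // b ∉ Set.range f} → W))) := by
    refine card_equiv e fun ω => ?_
    simp [← he]
  rw [h1, card_product, Fintype.card_congr e, Fintype.card_prod, card_univ]
  ring

open Classical in
-- By `hinj` the colours are the coins at pairwise different positions, hence independent and
-- uniform.
theorem card_drawnColours_mem {n M S b r w : ℕ} (own : Fin n → Fin M)
    (slot : Fin r → Fin n → ℕ) (hslot : ∀ ρ v, slot ρ v < w) (hw : w ≤ S)
    (hinj : ∀ ρ ρ' v v', own v = own v' → slot ρ v = slot ρ' v' → ρ = ρ' ∧ v = v')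
    (E : Finset (Fin r → Fin n → Word b)) :
    #{ω : Coins M S b 6 | drawnColours own slot hslot hw ω ∈ E} *
      Fintype.card (Fin r → Fin n → Word b) = #E * Fintype.card (Coins M S b 6) := by
  let f : Fin r × Fin n → (Fin 6 × Fin M) × Fin S :=
    fun p => ((1, own p.2), ⟨slot p.1 p.2, (hslot _ _).trans_le hw⟩)
  have hf : Function.Injective f := by
    rintro ⟨ρ, v⟩ ⟨ρ', v'⟩ h
    simp only [f, Prod.mk.injEq, Fin.mk.injEq, true_and] at h
    have := hinj ρ ρ' v v' h.1 h.2
    simp [this]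
  let e : Coins M S b 6 ≃ ((Fin 6 × Fin M) × Fin S → Word b) :=
    (Equiv.curry _ _ _).symm.trans (Equiv.curry _ _ _).symm
  let c : (Fin r → Fin n → Word b) ≃ (Fin r × Fin n → Word b) := (Equiv.curry _ _ _).symm
  have h := card_comp_mem f hf (E.map c.toEmbedding)
  rw [card_map] at h
  have hc := Fintype.card_congr c
  have he := Fintype.card_congr e
  rw [hc, he]
  convert h using 2
  refine card_equiv e fun ω => ?_
  simp only [mem_filter, mem_univ, true_and, mem_map_equiv]
  rfl

open Classical in
theorem le_uniformOn_real {Ω : Type*} [Fintype Ω] [Nonempty Ω] [MeasurableSpace Ω]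
    [MeasurableSingletonClass Ω] (s : Set Ω) (B : Finset Ω) (h : ∀ ω, ω ∉ B → ω ∈ s) {p : ℝ}
    (hB : (#B : ℝ) ≤ p * Fintype.card Ω) :
    1 - p ≤ (ProbabilityTheory.uniformOn (Set.univ : Set Ω)).real s := by
  have hpos : (0 : ℝ) < Fintype.card Ω := by exact_mod_cast Fintype.card_pos
  have h1 : ((Bᶜ : Finset Ω) : Set Ω) ⊆ s := fun ω hω => h ω (by simpa using hω)
  refine le_trans ?_ (MeasureTheory.measureReal_mono h1)
  rw [MeasureTheory.measureReal_def, ProbabilityTheory.uniformOn_univ,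
    MeasureTheory.Measure.count_apply_finset, ENNReal.toReal_div, ENNReal.toReal_natCast,
    ENNReal.toReal_natCast, le_div_iff₀ hpos, card_compl, Nat.cast_sub (card_le_univ B)]
  linarith

/-- A word determines a uniformly random pair of field elements. -/
theorem exists_uniform_loc (F : Type*) [Field F] [Fintype F] {b k : ℕ}
    (hF : Fintype.card F = 2 ^ k) (hk : 2 * k ≤ b) :
    ∃ loc : Word b → F × F, ∀ g : F × F → ℝ, 𝔼 w, g (loc w) = 𝔼 p, g p := by
  -- As `card F` is a power of two, the words split evenly among the points; this is the reason for
  -- using a field of characteristic two.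
  have hcard : Fintype.card (Word b) = Fintype.card ((F × F) × Fin (2 ^ (b - 2 * k))) := by
    simp only [Fintype.card_prod, Fintype.card_fin, hF]
    rw [← pow_add, ← pow_add]
    congr 1
    omega
  let e := Fintype.equivOfCardEq hcard
  refine ⟨fun w => (e w).1, fun g => ?_⟩
  rw [Fintype.expect_equiv e (fun w => g (e w).1) (fun p => g p.1) fun _ => rfl,
    ← univ_product_univ, expect_product]
  simp

/-! ### Combining the repetitions -/

open Classical in
/-- A number to which the majority of the estimates is close. -/
noncomputable def majority {r : ℕ} (e : ℝ) (Y : Fin r → ℝ) : ℕ :=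
  if h : ∃ y : ℕ, r < 2 * #{ρ | |Y ρ - y| ≤ e * y} then h.choose else 0

open Classical in
-- The estimates close to `y` and those close to `T` are both majorities, so they share one; it is
-- close to both numbers.
theorem abs_majority_sub_le {r : ℕ} {e ε : ℝ} (he : 0 ≤ e) (he1 : e ≤ 1 / 4) (heε : e ≤ ε / 4)
    (Y : Fin r → ℝ) (T : ℕ) (h : r < 2 * #{ρ | |Y ρ - T| ≤ e * T}) :
    |(majority e Y : ℝ) - T| ≤ ε * T := by
  have hex : ∃ y : ℕ, r < 2 * #{ρ | |Y ρ - y| ≤ e * y} := ⟨T, h⟩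
  rw [majority, dif_pos hex]
  have hy := hex.choose_spec
  set y := hex.choose
  obtain ⟨ρ, hρ⟩ : (({ρ | |Y ρ - T| ≤ e * T} : Finset (Fin r)) ∩
      ({ρ | |Y ρ - y| ≤ e * y} : Finset (Fin r))).Nonempty := by
    rw [← card_pos]
    have h1 := card_union_add_card_inter ({ρ | |Y ρ - T| ≤ e * T} : Finset (Fin r))
      ({ρ | |Y ρ - y| ≤ e * y} : Finset (Fin r))
    have h2 := card_le_univ (({ρ | |Y ρ - T| ≤ e * T} : Finset (Fin r)) ∪
      ({ρ | |Y ρ - y| ≤ e * y} : Finset (Fin r)))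
    rw [Fintype.card_fin] at h2
    omega
  simp only [mem_inter, mem_filter, mem_univ, true_and] at hρ
  obtain ⟨h1, h2⟩ := hρ
  rw [abs_le] at *
  have hT : (0 : ℝ) ≤ T := Nat.cast_nonneg T
  have hy0 : (0 : ℝ) ≤ y := Nat.cast_nonneg y
  have h3 := mul_le_mul_of_nonneg_right he1 hT
  have h4 := mul_le_mul_of_nonneg_right he1 hy0
  have h5 := mul_le_mul_of_nonneg_right heε hT
  -- The factor `5 / 3` is `(1 + 1 / 4) / (1 - 1 / 4)`.
  have h6 : e * y ≤ e * (5 / 3 * T) := mul_le_mul_of_nonneg_left (by linarith) he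
  constructor <;> linarith

/-! ### The sampling algorithm -/

section Assembly

variable {n M r b S : ℕ} {F : Type*} [Field F]

/-- The edges that a machine receives, if machines stand for a repetition and a line. -/
def machineSel (idx : Fin M ≃ Fin r × (F × F)) (loc : Word b → F × F)
    (χ : Fin r → Fin n → Word b) (i : Fin M) : Fin n → Fin n → Prop :=
  lineSel loc (idx i).2 (χ (idx i).1)

theorem machineSel_symm {idx : Fin M ≃ Fin r × (F × F)} {loc : Word b → F × F}
    (χ : Fin r → Fin n → Word b) (i : Fin M) (u v : Fin n) (h : machineSel idx loc χ i u v) :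
    machineSel idx loc χ i v u :=
  Connects.symm h

/-- In each repetition at most one line connects the points of `u` and `v`. -/
theorem ncard_machineSel_le (idx : Fin M ≃ Fin r × (F × F)) (loc : Word b → F × F)
    (χ : Fin r → Fin n → Word b) (u v : Fin n) : {i | machineSel idx loc χ i u v}.ncard ≤ r := by
  calc {i | machineSel idx loc χ i u v}.ncard ≤ (Set.univ : Set (Fin r)).ncard := by
        refine Set.ncard_le_ncard_of_injOn (fun i => (idx i).1) (fun _ _ => Set.mem_univ _) ?_
          (Set.toFinite _)
        intro i hi j hj hij
        simp only at hij
        have hi' : lineSel loc (idx i).2 (χ (idx i).1) u v := hi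
        have hj' : lineSel loc (idx j).2 (χ (idx j).1) u v := hj
        rw [← hij] at hj'
        exact idx.injective (Prod.ext hij (hi'.unique hj'))
    _ = r := by simp [Set.ncard_univ]

variable [Fintype F]

/-- The machine that draws the colours of `v`. -/
def colourOwner (hM : 0 < M) (v : Fin n) : Fin M :=
  ⟨v / (n / M + 1), by
    rw [Nat.div_lt_iff_lt_mul (Nat.succ_pos _), mul_comm]
    exact v.2.trans (by simpa [mul_comm] using Nat.lt_mul_div_succ n hM)⟩

/-- The position of the colours of `v` among those drawn by the same machine. -/
def colourSlot (M r : ℕ) (ρ : Fin r) (v : Fin n) : ℕ := (v % (n / M + 1)) * r + ρ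

theorem colourSlot_lt (ρ : Fin r) (v : Fin n) : colourSlot M r ρ v < (n / M + 1) * r := by
  have h1 : (v : ℕ) % (n / M + 1) < n / M + 1 := Nat.mod_lt _ (Nat.succ_pos _)
  have h2 := ρ.2
  rw [colourSlot]
  nlinarith

theorem colourSlot_injective (hM : 0 < M) (ρ ρ' : Fin r) (v v' : Fin n)
    (h : colourOwner hM v = colourOwner hM v') (h' : colourSlot M r ρ v = colourSlot M r ρ' v') :
    ρ = ρ' ∧ v = v' := by
  have hr : 0 < r := ρ.pos
  have h1 : (v : ℕ) / (n / M + 1) = v' / (n / M + 1) := congrArg Fin.val h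
  have h2 : (ρ : ℕ) = ρ' := by
    have := congrArg (· % r) h'
    simpa [colourSlot, Nat.mul_add_mod', Nat.mod_eq_of_lt ρ.2, Nat.mod_eq_of_lt ρ'.2] using this
  have h3 : (v : ℕ) % (n / M + 1) = v' % (n / M + 1) := by
    rw [colourSlot, colourSlot, h2] at h'
    exact Nat.eq_of_mul_eq_mul_right hr (Nat.add_right_cancel h')
  refine ⟨Fin.ext h2, Fin.ext ?_⟩
  rw [← Nat.div_add_mod (v : ℕ) (n / M + 1), ← Nat.div_add_mod (v' : ℕ) (n / M + 1), h1, h3]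

/-- The output of the sampling algorithm, computed from the numbers of triangles that the
machines found. -/
noncomputable def estimate (idx : Fin M ≃ Fin r × (F × F)) (e : ℝ) (count : Fin M → ℕ) : ℚ :=
  majority e fun ρ => ((∑ ℓ, count (idx.symm (ρ, ℓ)) : ℕ) : ℝ) / alignProb F

/-- The algorithm that estimates the number of triangles. -/
noncomputable def triangleSampler (S : ℕ) (hb : n ≤ 2 ^ b) (hM : 0 < M)
    (idx : Fin M ≃ Fin r × (F × F)) (loc : Word b → F × F) (e : ℝ) : Algorithm M S b 6 :=
  sampler S hb ((n / M + 1) * r) (colourOwner hM) (colourSlot M r) (machineSel idx loc) ⟨0, hM⟩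
    (estimate idx e)

theorem triangleSampler_respectsSpace {hb : n ≤ 2 ^ b} {hM : 0 < M}
    {idx : Fin M ≃ Fin r × (F × F)} {loc : Word b → F × F} {e : ℝ}
    {G : SimpleGraph (Fin n)} [DecidableRel G.Adj] {input : Fin M → List (Fin n × Fin n)}
    (hinput : IsEdgeDistribution G S input) (ω : Coins M S b 6)
    (hcard : G.edgeFinset.card < 2 ^ b) (hb0 : b ≠ 0)
    (hS : M * ((n / M + 1) * r + 1) + 2 * (G.edgeFinset.card / M + M) ≤ S)
    (hS' : 2 * (r * (G.edgeFinset.card / M + M)) ≤ S) :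
    (triangleSampler S hb hM idx loc e).RespectsSpace (initialMemory hb input) ω :=
  sampler_respectsSpace ω colourSlot_lt
    (((Nat.le_succ _).trans (Nat.le_mul_of_pos_left _ hM)).trans ((Nat.le_add_right _ _).trans hS))
    hinput (machineSel_symm) hcard hb0 hS (ncard_machineSel_le idx loc) hS'

open Classical in
theorem triangleSampler_accurate {hb : n ≤ 2 ^ b} {hM : 0 < M}
    {idx : Fin M ≃ Fin r × (F × F)} {loc : Word b → F × F}
    (hloc : ∀ g : F × F → ℝ, 𝔼 w, g (loc w) = 𝔼 p, g p) {e ε : ℝ}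
    {G : SimpleGraph (Fin n)} [DecidableRel G.Adj] {input : Fin M → List (Fin n × Fin n)}
    (hinput : IsEdgeDistribution G S input)
    (hcard : G.edgeFinset.card < 2 ^ b) (hb0 : b ≠ 0) (hcube : n ^ 3 < 2 ^ b)
    (hw : (n / M + 1) * r ≤ S)
    (hF : 4 ≤ Fintype.card F) (he : 0 < e) (he1 : e ≤ 1 / 4) (heε : e ≤ ε / 4) (hS0 : 0 < S / 2)
    (h1 : 192 / e ^ 2 ≤ alignProb F * triangleCount G)
    (h2 : 192 / e ^ 2 ≤ Fintype.card F - 1)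
    (h3 : 96 * (G.edgeFinset.card * (1 / (Fintype.card F : ℝ)) ^ 2 + 9 +
        3 * n * (1 / (Fintype.card F : ℝ))) ≤ e * (S / 2 : ℕ)) :
    1 - 1 / 2 ^ r ≤ (ProbabilityTheory.uniformOn (Set.univ : Set (Coins M S b 6))).real
      {ω | |((triangleSampler S hb hM idx loc e).result (initialMemory hb input) ω : ℝ)
        - (triangleCount G : ℝ)| ≤ ε * (triangleCount G : ℝ)} := by
  set bad : Finset (Fin n → Word b) := {χ | e * triangleCount G <
      |(counted G loc (S / 2) χ : ℝ) / alignProb F - triangleCount G|} with hbad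
  have hbad16 : 16 * #bad ≤ Fintype.card (Fin n → Word b) :=
    card_bad_le G hloc hF he hS0 h1 h2 h3
  set E : Finset (Fin r → Fin n → Word b) := {χ | r ≤ 2 * #{ρ | χ ρ ∈ bad}} with hE
  have hEcard := card_majority_bad bad hbad16 r
  have hcoins := card_drawnColours_mem (colourOwner hM) (colourSlot M r) colourSlot_lt hw
    (colourSlot_injective hM) E
  refine le_uniformOn_real _ ({ω : Coins M S b 6 |
    drawnColours (colourOwner hM) (colourSlot M r) colourSlot_lt hw ω ∈ E} : Finset _) ?_ ?_
  · intro ω hω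
    rw [mem_filter] at hω
    set χ := drawnColours (colourOwner hM) (colourSlot M r) colourSlot_lt hw ω with hχ
    have hχE : ¬ r ≤ 2 * #{ρ | χ ρ ∈ bad} := fun h => hω ⟨mem_univ _, by
      rw [hE, mem_filter]; exact ⟨mem_univ _, h⟩⟩
    change |((triangleSampler S hb hM idx loc e).result (initialMemory hb input) ω : ℝ)
        - (triangleCount G : ℝ)| ≤ ε * (triangleCount G : ℝ)
    rw [triangleSampler, sampler_result ω colourSlot_lt hw hinput
      machineSel_symm hcard hb0 hcube, estimate, Rat.cast_natCast]
    refine abs_majority_sub_le he.le he1 heε _ _ ?_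
    have hY : ∀ ρ, ∑ ℓ, cappedTriangles G (S / 2) (machineSel idx loc χ (idx.symm (ρ, ℓ))) =
        counted G loc (S / 2) (χ ρ) := fun ρ => by
      simp [machineSel, counted]
    simp only [← hχ, hY]
    have hcompl : #{ρ | χ ρ ∈ bad} + #{ρ | ¬ χ ρ ∈ bad} = r := by
      rw [card_filter_add_card_filter_not, card_univ, Fintype.card_fin]
    have hsub : #{ρ | ¬ χ ρ ∈ bad} ≤ #{ρ | |(counted G loc (S / 2) (χ ρ) : ℝ) / alignProb F -
        triangleCount G| ≤ e * triangleCount G} := by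
      refine card_le_card fun ρ hρ => ?_
      rw [mem_filter] at hρ ⊢
      refine ⟨mem_univ _, le_of_not_gt fun h => hρ.2 ?_⟩
      rw [hbad, mem_filter]
      exact ⟨mem_univ _, h⟩
    omega
  · have hN : (0 : ℝ) < Fintype.card (Fin r → Fin n → Word b) := by
      exact_mod_cast Fintype.card_pos
    have hN' : Fintype.card (Fin r → Fin n → Word b) = Fintype.card (Fin n → Word b) ^ r := by
      rw [Fintype.card_fun, Fintype.card_fin]
    rw [← hN'] at hEcard
    rw [one_div, ← div_eq_inv_mul, le_div_iff₀ (by positivity)]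
    refine le_of_mul_le_mul_right ?_ hN
    have h5 : (2 : ℝ) ^ r * #E ≤ Fintype.card (Fin r → Fin n → Word b) := by exact_mod_cast hEcard
    have h6 := congrArg (Nat.cast (R := ℝ)) hcoins
    push_cast only [Nat.cast_mul] at h6
    rw [mul_right_comm, h6]
    have h7 := mul_le_mul_of_nonneg_right h5 (Nat.cast_nonneg (Fintype.card (Coins M S b 6)))
    linarith

end Assembly

/-! ### The choice of the parameters -/

section Parameters

/-- The squares of powers of two are the powers of `4`, so one lies within a factor `4` below `m /
(8 * N ^ 2 * n)`. That `m` is large compared with `n` makes `2 ^ k` exceed `N + 1`. -/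
theorem exists_exponent {n m N : ℕ} (hn : 0 < n) (hN : 0 < N)
    (hm : 32 * N ^ 2 * (N + 1) ^ 2 * n < m) :
    ∃ k : ℕ, 8 * N ^ 2 * n * (2 ^ k) ^ 2 ≤ m ∧ m < 32 * N ^ 2 * n * (2 ^ k) ^ 2 ∧ N + 1 < 2 ^ k := by
  set x := m / (8 * N ^ 2 * n) with hx
  have hD : 0 < 8 * N ^ 2 * n := by positivity
  have hDm : 8 * N ^ 2 * n ≤ m := by
    refine le_trans ?_ hm.le
    calc 8 * N ^ 2 * n = 8 * N ^ 2 * 1 * n := by ring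
      _ ≤ 32 * N ^ 2 * (N + 1) ^ 2 * n := by
        gcongr
        · norm_num
        · exact Nat.one_le_pow _ _ (Nat.succ_pos _)
  have hx0 : x ≠ 0 := (Nat.div_pos hDm hD).ne'
  have h4 : ∀ k : ℕ, (2 ^ k) ^ 2 = 4 ^ k := fun k => by
    rw [← pow_mul, mul_comm, pow_mul]; norm_num
  have h1 : 8 * N ^ 2 * n * (2 ^ Nat.log 4 x) ^ 2 ≤ m := by
    rw [h4, mul_comm]
    exact (Nat.mul_le_mul_right _ (Nat.pow_log_le_self 4 hx0)).trans (Nat.div_mul_le_self _ _)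
  have h2 : m < 32 * N ^ 2 * n * (2 ^ Nat.log 4 x) ^ 2 := by
    rw [h4]
    have h : x < 4 ^ (Nat.log 4 x + 1) := Nat.lt_pow_succ_log_self (by norm_num) x
    rw [hx, Nat.div_lt_iff_lt_mul hD] at h
    refine h.trans_eq ?_
    rw [← hx]
    ring
  refine ⟨_, h1, h2, ?_⟩
  have h3 : (N + 1) ^ 2 < (2 ^ Nat.log 4 x) ^ 2 := by
    have h5 := hm.trans h2
    refine Nat.lt_of_mul_lt_mul_left (a := 32 * N ^ 2 * n) ?_
    linarith
  exact lt_of_pow_lt_pow_left₀ 2 (Nat.zero_le _) h3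

variable {n m N r q : ℕ}

/-- Since `m ≤ n ^ 2`, there are at most `r * n` machines, so that each can send a packet to every
other; moreover a random point fits into a word. -/
theorem sq_le_of_le (hn : 0 < n) (hN : 0 < N) (hm : m ≤ n.choose 2)
    (h1 : 8 * N ^ 2 * n * q ^ 2 ≤ m) : q ^ 2 ≤ n := by
  refine le_of_mul_le_mul_left (a := n) ?_ hn
  calc n * q ^ 2 ≤ 8 * N ^ 2 * n * q ^ 2 := by
        gcongr
        refine Nat.le_mul_of_pos_left _ (by positivity)
    _ ≤ n ^ 2 := h1.trans (hm.trans (Nat.choose_le_pow n 2))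
    _ = n * n := sq n

theorem div_machines_le (hr : 0 < r)
    (h2 : m < 32 * N ^ 2 * n * q ^ 2) : m / (r * q ^ 2) ≤ 32 * N ^ 2 * n := by
  refine Nat.div_le_of_le_mul ?_
  calc m ≤ 1 * (32 * N ^ 2 * n * q ^ 2) := by linarith
    _ ≤ r * (32 * N ^ 2 * n * q ^ 2) := Nat.mul_le_mul_right _ hr
    _ = _ := by ring

theorem messages_le (hN : 0 < N) (hr : 0 < r) (hqn : q ^ 2 ≤ n)
    (h2 : m < 32 * N ^ 2 * n * q ^ 2) :
    r * q ^ 2 * ((n / (r * q ^ 2) + 1) * r + 1) + 2 * (m / (r * q ^ 2) + r * q ^ 2) ≤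
      200 * N ^ 4 * r ^ 2 * n := by
  have h3 := div_machines_le hr h2
  have h4 : r * q ^ 2 * (n / (r * q ^ 2)) ≤ n := Nat.mul_div_le _ _
  have h5 : r * q ^ 2 ≤ r * n := Nat.mul_le_mul_left _ hqn
  have h6 : r ≤ r ^ 2 := Nat.le_self_pow two_ne_zero r
  have h7 : N ^ 2 ≤ N ^ 4 := Nat.pow_le_pow_right hN (by norm_num)
  have h8 : 1 ≤ N ^ 4 := Nat.one_le_pow _ _ hN
  have h9 : 1 ≤ r ^ 2 := Nat.one_le_pow _ _ hr
  calc _ = r * q ^ 2 * (n / (r * q ^ 2)) * r + r * q ^ 2 * r + 3 * (r * q ^ 2) +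
        2 * (m / (r * q ^ 2)) := by ring
    _ ≤ n * r + r * n * r + 3 * (r * n) + 2 * (32 * N ^ 2 * n) := by gcongr
    _ = (4 * r + r ^ 2 + 64 * N ^ 2 * 1) * n := by ring
    _ ≤ (4 * r ^ 2 + r ^ 2 + 64 * N ^ 4 * r ^ 2) * n := by gcongr
    _ = (5 * 1 + 64 * N ^ 4) * r ^ 2 * n := by ring
    _ ≤ (5 * N ^ 4 + 64 * N ^ 4) * r ^ 2 * n := by gcongr
    _ = 69 * N ^ 4 * r ^ 2 * n := by ring
    _ ≤ _ := by gcongr; norm_num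

theorem edges_le (hN : 0 < N) (hr : 0 < r) (hqn : q ^ 2 ≤ n)
    (h2 : m < 32 * N ^ 2 * n * q ^ 2) :
    2 * (r * (m / (r * q ^ 2) + r * q ^ 2)) ≤ 200 * N ^ 4 * r ^ 2 * n := by
  have h3 := div_machines_le hr h2
  have h6 : r ≤ r ^ 2 := Nat.le_self_pow two_ne_zero r
  have h7 : N ^ 2 ≤ N ^ 4 := Nat.pow_le_pow_right hN (by norm_num)
  have h8 : 1 ≤ N ^ 4 := Nat.one_le_pow _ _ hN
  calc 2 * (r * (m / (r * q ^ 2) + r * q ^ 2)) ≤ 2 * (r * (32 * N ^ 2 * n + r * n)) := by gcongr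
    _ = (64 * N ^ 2 * r + 2 * 1 * r ^ 2) * n := by ring
    _ ≤ (64 * N ^ 4 * r ^ 2 + 2 * N ^ 4 * r ^ 2) * n := by gcongr
    _ = 66 * N ^ 4 * r ^ 2 * n := by ring
    _ ≤ _ := by gcongr; norm_num

theorem half_space : 200 * N ^ 4 * r ^ 2 * n / 2 = 100 * N ^ 4 * r ^ 2 * n := by
  rw [show 200 * N ^ 4 * r ^ 2 * n = 2 * (100 * N ^ 4 * r ^ 2 * n) by ring]
  exact Nat.mul_div_cancel_left _ two_pos

theorem capacity_le (hN : 0 < N) (hr : 0 < r) (h2 : m < 32 * N ^ 2 * n * q ^ 2) :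
    m ≤ r * q ^ 2 * (200 * N ^ 4 * r ^ 2 * n / 2) := by
  rw [half_space]
  have h7 : N ^ 2 ≤ N ^ 4 := Nat.pow_le_pow_right hN (by norm_num)
  have h9 : 1 ≤ r ^ 2 := Nat.one_le_pow _ _ hr
  have hr1 : 1 ≤ r := hr
  calc m ≤ 1 * q ^ 2 * (32 * N ^ 2 * 1 * n) := by linarith
    _ ≤ r * q ^ 2 * (100 * N ^ 4 * r ^ 2 * n) := by gcongr; norm_num

variable {F : Type*} [Fintype F]

theorem alignProb_ge (hF : 4 ≤ Fintype.card F) :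
    1 / (4 * (Fintype.card F : ℝ)) ≤ alignProb F := by
  have hq : (4 : ℝ) ≤ Fintype.card F := by exact_mod_cast hF
  rw [alignProb, extensionProb]
  generalize (Fintype.card F : ℝ) = x at *
  have hx : 0 < x := by linarith
  rw [div_le_iff₀ (by positivity)]
  have : (x - 2) / x ^ 2 * (1 - 1 / x) * (4 * x) = 4 * (x - 2) * (x - 1) / x ^ 2 := by
    field_simp
  rw [this, le_div_iff₀ (by positivity)]
  nlinarith

/-- The only use of `T ≥ √d_avg`: the average degree `2 * m / n` is at least `(4 * N * q) ^ 2`, and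
`alignProb` is at least `1 / (4 * q)`. -/
theorem le_alignProb_mul (hF : 4 ≤ Fintype.card F) {G : SimpleGraph (Fin n)}
    [DecidableRel G.Adj] (hn : 0 < n)
    (h1 : 8 * N ^ 2 * n * Fintype.card F ^ 2 ≤ G.edgeFinset.card)
    (hT : √(avgDegree G) ≤ (triangleCount G : ℝ)) : (N : ℝ) ≤ alignProb F * triangleCount G := by
  have hq : (4 : ℝ) ≤ Fintype.card F := by exact_mod_cast hF
  have hn' : (0 : ℝ) < n := by exact_mod_cast hn
  have h2 : 4 * N * (Fintype.card F : ℝ) ≤ triangleCount G := by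
    refine le_trans (Real.le_sqrt_of_sq_le ?_) hT
    have h3 : (∑ v, (G.degree v : ℝ)) = 2 * G.edgeFinset.card := by
      exact_mod_cast G.sum_degrees_eq_twice_card_edges
    have h4 : 8 * (N : ℝ) ^ 2 * n * (Fintype.card F : ℝ) ^ 2 ≤ G.edgeFinset.card := by
      exact_mod_cast h1
    rw [avgDegree, h3, le_div_iff₀ hn']
    linarith
  calc (N : ℝ) = 1 / (4 * (Fintype.card F : ℝ)) * (4 * N * (Fintype.card F : ℝ)) := by
        field_simp
    _ ≤ alignProb F * triangleCount G := by
        refine mul_le_mul (alignProb_ge hF) h2 (by positivity) ?_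
        exact le_trans (by positivity) (alignProb_ge hF)

/-- The load is of order `N ^ 2 * n`. The higher power of `N` in the space bound compensates for the
factor `e`, because `192 ≤ e * N`. -/
theorem load_le {e : ℝ} (he : 0 < e) (he1 : e ≤ 1 / 4) (hN : 192 / e ^ 2 ≤ N) (hn : 0 < n)
    (hr : 0 < r) (hq : 0 < q) (h2 : m < 32 * N ^ 2 * n * q ^ 2) :
    96 * (m * (1 / (q : ℝ)) ^ 2 + 9 + 3 * n * (1 / (q : ℝ))) ≤
      e * (200 * N ^ 4 * r ^ 2 * n / 2 : ℕ) := by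
  rw [half_space]
  have hq' : (1 : ℝ) ≤ q := by exact_mod_cast hq
  have hn' : (1 : ℝ) ≤ n := by exact_mod_cast hn
  have hr' : (1 : ℝ) ≤ (r : ℝ) ^ 2 := by exact_mod_cast Nat.one_le_pow _ _ hr
  have h3 : (m : ℝ) * (1 / (q : ℝ)) ^ 2 ≤ 32 * N ^ 2 * n := by
    rw [one_div, inv_pow, ← div_eq_mul_inv, div_le_iff₀ (by positivity)]
    exact_mod_cast h2.le
  have h4 : 3 * n * (1 / (q : ℝ)) ≤ 3 * n :=
    mul_le_of_le_one_right (by positivity) ((div_le_one (by positivity)).2 hq')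
  have h5 : 192 ≤ e * N := by
    rw [div_le_iff₀ (by positivity)] at hN
    have hN0 : (0 : ℝ) ≤ N := Nat.cast_nonneg N
    have : e * (e * N) ≤ 1 * (e * N) := mul_le_mul_of_nonneg_right (by linarith) (by positivity)
    linarith
  have hN1 : (1 : ℝ) ≤ N := by
    have hN0 : (0 : ℝ) ≤ N := Nat.cast_nonneg N
    nlinarith
  have hN2 : (1 : ℝ) ≤ (N : ℝ) ^ 2 := one_le_pow₀ hN1
  have hN3 : (N : ℝ) ^ 2 ≤ (N : ℝ) ^ 3 := pow_le_pow_right₀ hN1 (by norm_num)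
  calc _ ≤ 96 * (32 * N ^ 2 * n + 9 * n + 3 * n : ℝ) := by linarith
    _ = 96 * (32 * N ^ 2 + 12 * 1) * n := by ring
    _ ≤ 96 * (32 * N ^ 3 + 12 * N ^ 3) * n := by gcongr; exact hN2.trans hN3
    _ ≤ 192 * (100 * N ^ 3) * n * 1 := by
        have : 0 ≤ (N : ℝ) ^ 3 * n := by positivity
        linarith
    _ ≤ (e * N) * (100 * N ^ 3) * n * r ^ 2 := by gcongr
    _ = _ := by push_cast; ring

theorem natLog_le (n : ℕ) : ((Nat.log 2 n + 1 : ℕ) : ℝ) ≤ 3 * Real.log (n + 2) := by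
  have h2 : (2 : ℝ) / 3 ≤ Real.log 2 := by linarith [Real.log_two_gt_d9]
  have h1 : 2 ^ (Nat.log 2 n + 1) ≤ (n + 2) ^ 2 := by
    rcases Nat.eq_zero_or_pos n with rfl | hn
    · simp
    · have := Nat.pow_log_le_self 2 hn.ne'
      rw [pow_succ]
      nlinarith
  have h3 : Real.log (2 ^ (Nat.log 2 n + 1)) ≤ Real.log ((n + 2 : ℝ) ^ 2) :=
    Real.log_le_log (by positivity) (by exact_mod_cast h1)
  rw [Real.log_pow, Real.log_pow] at h3
  have h4 : (0 : ℝ) ≤ ((Nat.log 2 n + 1 : ℕ) : ℝ) := Nat.cast_nonneg _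
  push_cast at *
  nlinarith

end Parameters

end MPC

/-! ### The theorem: choice of constants, sparse and dense case -/

theorem mainTheorem2 :
    ∃ R c K : ℕ, ∀ ε : ℝ, 0 < ε → ∀ κ : ℕ, ∃ (C : ℝ) (S : ℕ → ℕ),
      (∀ n : ℕ, n ≤ S n ∧ (S n : ℝ) ≤ C * Real.log (n + 2) ^ c * n) ∧
      ∀ n m : ℕ, m ≤ n.choose 2 →
        ∃ (M b : ℕ) (hb : n ≤ 2 ^ b) (A : MPC.Algorithm M (S n) b R),
          (b : ℝ) ≤ K * Real.log (n + 2) ∧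
          m ≤ M * (S n / 2) ∧
          (M : ℝ) * (S n : ℝ) ≤ C * Real.log (n + 2) ^ c * max (n : ℝ) (m : ℝ) ∧
          ∀ (G : SimpleGraph (Fin n)) [DecidableRel G.Adj], G.edgeFinset.card = m →
            ∀ input : Fin M → List (Fin n × Fin n), MPC.IsEdgeDistribution G (S n) input →
              (∀ ω, A.RespectsSpace (MPC.initialMemory hb input) ω) ∧
              (√(MPC.avgDegree G) ≤ (MPC.triangleCount G : ℝ) →
                1 - 1 / (n : ℝ) ^ κ ≤
                  (ProbabilityTheory.uniformOn
                    (Set.univ : Set (MPC.Coins M (S n) b R))).real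
                    {ω | |(A.result (MPC.initialMemory hb input) ω : ℝ)
                        - (MPC.triangleCount G : ℝ)| ≤ ε * (MPC.triangleCount G : ℝ)}) := by
  open MPC in
  -- The exponent `3` comes from a factor `r ^ 2` in `S` and a factor `r` in the number of machines;
  -- a word has `3 * L n` bits, and `L n ≤ 3 * log (n + 2)` gives `9`.
  refine ⟨6, 3, 9, fun ε hε κ => ?_⟩
  set e := min ε 1 / 4 with he_def
  have he : 0 < e := by positivity
  have he1 : e ≤ 1 / 4 := by
    have := min_le_right ε 1
    rw [he_def]; linarith
  have heε : e ≤ ε / 4 := by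
    have := min_le_left ε 1
    rw [he_def]; linarith
  obtain ⟨N, hN⟩ := exists_nat_ge (192 / e ^ 2)
  have hN3 : 3 ≤ N := by
    rw [div_le_iff₀ (by positivity)] at hN
    have h1 : e ^ 2 ≤ 1 := by nlinarith
    have h2 : (192 : ℝ) ≤ N * 1 := hN.trans (mul_le_mul_of_nonneg_left h1 (Nat.cast_nonneg N))
    have h3 : (3 : ℝ) ≤ N := by linarith
    exact_mod_cast h3
  have hN0 : 0 < N := by omega
  set L : ℕ → ℕ := fun n => Nat.log 2 n + 1 with hL
  set r : ℕ → ℕ := fun n => (κ + 1) * L n with hr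
  have hr0 : ∀ n, 0 < r n := fun n => Nat.mul_pos κ.succ_pos (Nat.succ_pos _)
  have hlog : ∀ n : ℕ, 0 ≤ Real.log (n + 2) := fun n => Real.log_nonneg (by
    have : (0 : ℝ) ≤ n := Nat.cast_nonneg n
    linarith)
  have hrlog : ∀ n, (r n : ℝ) ^ 3 ≤ (3 * (κ + 1)) ^ 3 * Real.log (n + 2) ^ 3 := fun n => by
    rw [← mul_pow]
    refine pow_le_pow_left₀ (Nat.cast_nonneg _) ?_ 3
    have := mul_le_mul_of_nonneg_left (natLog_le n) (by positivity : (0 : ℝ) ≤ κ + 1)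
    simp only [hr, hL]
    push_cast at *
    linarith
  set C : ℝ := 200 * N ^ 4 * (3 * (κ + 1)) ^ 3 with hC
  set S : ℕ → ℕ := fun n => 200 * N ^ 4 * r n ^ 2 * n with hS
  have hSn : ∀ n : ℕ, (S n : ℝ) ≤ C * Real.log (n + 2) ^ 3 * n := fun n => by
    have h1 : (r n : ℝ) ^ 2 ≤ (r n : ℝ) ^ 3 :=
      pow_le_pow_right₀ (by exact_mod_cast hr0 n) (by norm_num)
    calc (S n : ℝ) = 200 * N ^ 4 * (r n : ℝ) ^ 2 * n := by simp only [hS]; push_cast; ring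
      _ ≤ 200 * N ^ 4 * ((3 * (κ + 1)) ^ 3 * Real.log (n + 2) ^ 3) * n := by
        gcongr
        exact h1.trans (hrlog n)
      _ = _ := by rw [hC]; ring
  refine ⟨C, S, fun n => ⟨?_, hSn n⟩, fun n m hm => ?_⟩
  · have := hr0 n
    exact Nat.le_mul_of_pos_left n (by positivity)
  have hbn : n < 2 ^ L n := Nat.lt_pow_succ_log_self (by norm_num) n
  -- Words of this length hold vertices, edge counts and triangle counts without overflow.
  have hcube : n ^ 3 < 2 ^ (3 * L n) := by
    rw [mul_comm, pow_mul]
    exact Nat.pow_lt_pow_left hbn (by norm_num)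
  have hb : n ≤ 2 ^ (3 * L n) := hbn.le.trans (Nat.pow_le_pow_right (by norm_num) (by omega))
  have hb0 : 3 * L n ≠ 0 := by simp [hL]
  have hblog : ((3 * L n : ℕ) : ℝ) ≤ (9 : ℕ) * Real.log (n + 2) := by
    have := natLog_le n
    simp only [hL]
    push_cast at *
    linarith
  -- In the sparse case `q` could not be chosen large, but one machine can hold the graph.
  by_cases hmn : m ≤ 32 * N ^ 2 * (N + 1) ^ 2 * n
  · refine ⟨1, 3 * L n, hb, exactCounter n (S n) (3 * L n) 6, hblog, ?_, ?_, ?_⟩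
    · rw [one_mul]
      simp only [hS]
      rw [half_space]
      refine hmn.trans ?_
      have h1 : 32 * (N + 1) ^ 2 ≤ 100 * N ^ 2 := by nlinarith
      have h2 : 1 ≤ r n ^ 2 := Nat.one_le_pow _ _ (hr0 n)
      calc 32 * N ^ 2 * (N + 1) ^ 2 * n = N ^ 2 * (32 * (N + 1) ^ 2) * 1 * n := by ring
        _ ≤ N ^ 2 * (100 * N ^ 2) * r n ^ 2 * n := by gcongr
        _ = _ := by ring
    · rw [Nat.cast_one, one_mul]
      refine (hSn n).trans ?_
      have := hlog n
      gcongr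
      exact le_max_left _ _
    · intro G _ hG input hinput
      refine ⟨fun ω => exactCounter_respectsSpace hb ω hinput, fun _ => ?_⟩
      refine le_uniformOn_real _ ∅ (fun ω _ => ?_) ?_
      · change |((exactCounter n (S n) (3 * L n) 6).result (initialMemory hb input) ω : ℝ)
          - triangleCount G| ≤ ε * triangleCount G
        rw [exactCounter_result hb ω hinput, Rat.cast_natCast, sub_self, abs_zero]
        positivity
      · rw [Finset.card_empty, Nat.cast_zero]
        positivity
  · rw [not_le] at hmn
    have hn : 0 < n := by
      rcases Nat.eq_zero_or_pos n with rfl | hn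
      · simp at hm hmn
        omega
      · exact hn
    obtain ⟨k, hk1, hk2, hk3⟩ := exists_exponent hn hN0 hmn
    have hk0 : k ≠ 0 := by
      rintro rfl
      simp at hk3
    have hqn := sq_le_of_le hn hN0 hm hk1
    let _ : Fintype (GaloisField 2 k) := Fintype.ofFinite _
    have hF : Fintype.card (GaloisField 2 k) = 2 ^ k := by
      rw [← Nat.card_eq_fintype_card, GaloisField.card 2 k hk0]
    have hkb : 2 * k ≤ 3 * L n := by
      have h1 : 2 ^ (k * 2) < 2 ^ L n := by
        rw [pow_mul]
        exact hqn.trans_lt hbn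
      have h2 := (Nat.pow_lt_pow_iff_right (by norm_num)).1 h1
      omega
    obtain ⟨loc, hloc⟩ := exists_uniform_loc (GaloisField 2 k) hF hkb
    have hq0 : 0 < 2 ^ k := by positivity
    have hM : 0 < r n * (2 ^ k) ^ 2 := Nat.mul_pos (hr0 n) (by positivity)
    have hidx : Fintype.card (Fin (r n * (2 ^ k) ^ 2)) =
        Fintype.card (Fin (r n) × (GaloisField 2 k × GaloisField 2 k)) := by
      simp only [Fintype.card_prod, Fintype.card_fin, hF]
      ring
    have hmb : m < 2 ^ (3 * L n) :=
      (hm.trans ((Nat.choose_le_pow n 2).trans (Nat.pow_le_pow_right hn (by norm_num)))).trans_lt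
        hcube
    refine ⟨r n * (2 ^ k) ^ 2, 3 * L n, hb,
      triangleSampler (S n) hb hM (Fintype.equivOfCardEq hidx) loc e, hblog,
      capacity_le hN0 (hr0 n) hk2, ?_, ?_⟩
    · have h1 : n * (2 ^ k) ^ 2 ≤ m := by
        refine le_trans ?_ hk1
        gcongr
        exact Nat.le_mul_of_pos_left _ (by positivity)
      have h2 : (n : ℝ) * (2 ^ k) ^ 2 ≤ m := by exact_mod_cast h1
      have := hlog n
      calc ((r n * (2 ^ k) ^ 2 : ℕ) : ℝ) * (S n : ℝ) =
            200 * N ^ 4 * (r n : ℝ) ^ 3 * (n * (2 ^ k) ^ 2) := by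
            simp only [hS]; push_cast; ring
        _ ≤ 200 * N ^ 4 * ((3 * (κ + 1)) ^ 3 * Real.log (n + 2) ^ 3) * max (n : ℝ) m := by
            gcongr
            · exact hrlog n
            · exact h2.trans (le_max_right _ _)
        _ = _ := by rw [hC]; ring
    · intro G _ hG input hinput
      subst hG
      have hmsg := messages_le hN0 (hr0 n) hqn hk2
      refine ⟨fun ω => triangleSampler_respectsSpace hinput ω hmb hb0 hmsg
        (edges_le hN0 (hr0 n) hqn hk2), fun hT => ?_⟩
      have hF4 : 4 ≤ Fintype.card (GaloisField 2 k) := by omega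
      have hS0 : 0 < S n / 2 := by
        simp only [hS]
        rw [half_space]
        have := hr0 n
        positivity
      refine le_trans ?_ (triangleSampler_accurate hloc hinput hmb hb0 hcube
        (((Nat.le_succ _).trans (Nat.le_mul_of_pos_left _ hM)).trans
          ((Nat.le_add_right _ _).trans hmsg)) hF4 he he1 heε hS0
        (hN.trans (le_alignProb_mul hF4 hn (by rw [hF]; exact hk1) hT)) ?_ ?_)
      · have h1 : n ^ κ ≤ 2 ^ r n := by
          calc n ^ κ ≤ (2 ^ L n) ^ κ := Nat.pow_le_pow_left hbn.le κ
            _ = 2 ^ (L n * κ) := (pow_mul _ _ _).symm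
            _ ≤ 2 ^ r n := Nat.pow_le_pow_right (by norm_num) (by
              rw [hr]; nlinarith)
        have h2 : (n : ℝ) ^ κ ≤ 2 ^ r n := by exact_mod_cast h1
        have h3 : (0 : ℝ) < (n : ℝ) ^ κ := by positivity
        have := one_div_le_one_div_of_le h3 h2
        linarith
      · have h1 : ((N + 1 : ℕ) : ℝ) ≤ (2 ^ k : ℕ) := by exact_mod_cast hk3.le
        rw [hF]
        push_cast at *
        linarith
      · rw [hF]
        exact load_le he he1 hN hn (hr0 n) hq0 hk2
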